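/- Let $G$ be a finite simple graph with an arbitrary edge-colouring. For a vertex $v$, the colour degree $d^c(v)$ is the number of distinct colours on the edges incident to $v$, and $\delta^c(G)=\min_{v\in V(G)} d^c(v)$. A rainbow $K_3$ is a triangle of $G$ whose three edges have distinct colours. For $S\subseteq V(G)$, a perfect rainbow-$K_3$-tiling of the induced subgraph $G[S]$ is a collection of pairwise vertex-disjoint rainbow copies of $K_3$ in $G[S]$ that together cover every vertex of $S$ (colours may repeat between different copies). For every $\varepsilon>0$ there exists $\varphi_0>0$ such that for every $\varphi\in(0,\varphi_0]$ there exists $n_0\in\mathbb{N}$ such that the following holds for every $n\ge n_0$. If $G$ is an edge-coloured graph on $n$ vertices with $\delta^c(G)\ge(2/3+\varepsilon)n$, then there exists $W\subseteq V(G)$ with $|W|\le\varepsilon n$ such that $G[W]$ has a perfect rainbow-$K_3$-tiling and, for every $U\subseteq V(G)\setminus W$ with $|U|\le\varphi n$ and $3\mid |U|$, $G[U\cup W]$ has a perfect rainbow-$K_3$-tiling. -/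

import Mathlib

namespace RainbowTiling

variable {V K : Type*} {G : SimpleGraph V}

/-- The colour degree of `v`: the number of distinct colours on edges incident to `v`. -/
noncomputable def colourDegree (c : G.EdgeLabeling K) (v : V) : ℕ :=
  Set.ncard {k : K | ∃ e : G.edgeSet, v ∈ (e : Sym2 V) ∧ c e = k}

/-- The minimum colour degree of the edge-coloured graph `(G, c)`. -/
noncomputable def minColourDegree (c : G.EdgeLabeling K) : ℕ :=
  ⨅ v : V, colourDegree c v

/-- `T` is the vertex set of a rainbow `K_r`: it is an `r`-clique of `G`, and the edges of `G`
with both ends in `T` have pairwise distinct colours. -/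
def IsRainbowClique (c : G.EdgeLabeling K) (r : ℕ) (T : Finset V) : Prop :=
  G.IsNClique r T ∧
    ∀ e f : G.edgeSet, (∀ v ∈ (e : Sym2 V), v ∈ T) → (∀ v ∈ (f : Sym2 V), v ∈ T) →
      c e = c f → e = f

/-- The edge-coloured graph `G[S]` has a perfect rainbow-`K_r`-tiling: there are pairwise
vertex-disjoint rainbow copies of `K_r` whose vertex sets together cover exactly `S`.
Colours may repeat between different copies. -/
def HasPerfectRainbowTiling (c : G.EdgeLabeling K) (r : ℕ) (S : Finset V) : Prop :=
  ∃ P : Finset (Finset V),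
    (∀ T ∈ P, IsRainbowClique c r T) ∧
    (∀ T ∈ P, ∀ T' ∈ P, T ≠ T' → Disjoint T T') ∧
    (∀ v : V, v ∈ S ↔ ∃ T ∈ P, v ∈ T)

end RainbowTiling

/-! The proof is by absorption. For some `N` and `η > 0` depending only on `ε`, every triple `X` of
vertices has at least `η n^(3N)` absorbers: tuples of `3N` vertices whose set has a perfect rainbow
tiling both alone and together with `X` (`exists_many_absorbers`). A greedy choice gives a disjoint
family of small linear size with linearly many absorbers for each triple (`exists_disjoint_family`).
The set `W` is the union of this family, and `U` is absorbed three vertices at a time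
(`hasPerfectRainbowTiling_absorb`).

To build absorbers, select at each vertex one neighbour per colour, after dropping the colours that
occur there on linearly many edges. This gives a digraph whose out-degrees exceed `2n/3` by a linear
margin. With probability at least 1/2, a random tuple of constant length `M` inherits out-degrees
above `2M/3`, and no selected edge shares its colour at its tail with another edge of the tuple or
with an edge to `X`. Then three pairwise adjacent indices, each with an arc to another of the three,
span a rainbow triangle, since at each vertex one of the two edges is selected. Moreover, each `x`
in `X` has a double arc inside its out-neighbourhood, and this pair forms a rainbow triangle with
`x`.

The core is deterministic (`linked_of_outDegree`): if all out-degrees exceed two thirds of the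
order, the integer lattice of out-triangles contains all differences of unit vectors. The three
double arcs have coordinate sum 6, so their sum lies in the lattice and equals `P - Q` for two sums
of out-triangles (`exists_exchange_lists`). When indices are replaced by clones, `P` becomes the
tiling of the absorber alone, and `Q` with the three double arcs completed by `X` becomes the other
one. Pigeonhole over the finitely many configurations and a power-mean count of blow-ups
(`density_blowUp`) keep the density positive. -/

namespace RainbowTiling
open Finset

/-! ### The lattice of a triple system -/

section Lattice

variable {V : Type*} [DecidableEq V]

/-- The integer indicator vector of a finite set. -/
def indicatorVec (T : Finset V) : V → ℤ := ∑ x ∈ T, Pi.single x 1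

/-- The integer lattice spanned by the indicator vectors of the members of a family. -/
def spanLattice (E : Set (Finset V)) : AddSubgroup (V → ℤ) :=
  AddSubgroup.closure (Set.image indicatorVec E)

/-- Two vertices are linked if the difference of their unit vectors lies in the lattice. -/
def Linked (E : Set (Finset V)) (x y : V) : Prop :=
  (Pi.single x 1 - Pi.single y 1 : V → ℤ) ∈ spanLattice E

lemma Linked.refl (E : Set (Finset V)) (x : V) : Linked E x x := by
  simp [Linked]

lemma Linked.symm {E : Set (Finset V)} {x y : V} (h : Linked E x y) : Linked E y x := by
  have := (spanLattice E).neg_mem h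
  simpa [Linked] using this

lemma Linked.trans {E : Set (Finset V)} {x y z : V} (h : Linked E x y) (h' : Linked E y z) :
    Linked E x z := by
  have := (spanLattice E).add_mem h h'
  simpa [Linked] using this

lemma indicatorVec_triple {a b c : V} (h : ({a, b, c} : Finset V).card = 3) :
    indicatorVec {a, b, c} = Pi.single a 1 + Pi.single b 1 + Pi.single c 1 := by
  obtain ⟨hab, hac, hbc⟩ := card_triple_eq_three_iff.1 h
  rw [indicatorVec, sum_insert (by simp [hab, hac]), sum_insert (by simp [hbc]), sum_singleton,
    add_assoc]

/-- Subtracting one triple from the other, and then `a - a'` and `b - b'`, leaves `x - y`. This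
exchange is the only source of new links in the digraph argument. -/
lemma Linked.of_triples {E : Set (Finset V)} {a b x a' b' y : V}
    (h : ({a, b, x} : Finset V) ∈ E) (h' : ({a', b', y} : Finset V) ∈ E)
    (hc : ({a, b, x} : Finset V).card = 3) (hc' : ({a', b', y} : Finset V).card = 3)
    (ha : Linked E a a') (hb : Linked E b b') : Linked E x y := by
  have h1 : indicatorVec {a, b, x} ∈ spanLattice E :=
    AddSubgroup.subset_closure (Set.mem_image_of_mem _ h)
  have h2 : indicatorVec {a', b', y} ∈ spanLattice E :=
    AddSubgroup.subset_closure (Set.mem_image_of_mem _ h')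
  rw [indicatorVec_triple hc] at h1
  rw [indicatorVec_triple hc'] at h2
  have h3 := (spanLattice E).sub_mem ((spanLattice E).sub_mem ((spanLattice E).sub_mem h1 h2) ha) hb
  unfold Linked
  convert h3 using 1
  abel

end Lattice

/-! ### Out-triangles in digraphs of large out-degree -/

section Digraph

variable {V : Type*} [DecidableEq V]

/-- In the digraph with out-neighbourhoods `S`, the set `T` consists of three pairwise adjacent
vertices, each of which has an out-neighbour in `T`. -/
def OutTriangle (S : V → Finset V) (T : Finset V) : Prop :=
  T.card = 3 ∧ (∀ x ∈ T, ∀ y ∈ T, x ≠ y → y ∈ S x ∨ x ∈ S y) ∧ ∀ x ∈ T, ∃ y ∈ T, y ∈ S x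

/-- The in-neighbours of `b` that lie in `A`. -/
def inNbrs (S : V → Finset V) (A : Finset V) (b : V) : Finset V := A.filter fun v => b ∈ S v

lemma mem_inNbrs {S : V → Finset V} {A : Finset V} {b v : V} :
    v ∈ inNbrs S A b ↔ v ∈ A ∧ b ∈ S v := by simp [inNbrs]

lemma OutTriangle.of_cycle {S : V → Finset V} (hS : ∀ v, v ∉ S v) {a b c : V}
    (hab : b ∈ S a) (hbc : c ∈ S b) (hca : a ∈ S c) : OutTriangle S {a, b, c} := by
  have h1 : a ≠ b := by rintro rfl; exact hS _ hab
  have h2 : b ≠ c := by rintro rfl; exact hS _ hbc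
  have h3 : a ≠ c := by rintro rfl; exact hS _ hca
  refine ⟨card_triple_eq_three_iff.2 ⟨h1, h3, h2⟩, ?_, ?_⟩
  · simp only [mem_insert, mem_singleton]
    rintro x (rfl | rfl | rfl) y (rfl | rfl | rfl) <;> simp_all
  · simp only [mem_insert, mem_singleton]
    rintro x (rfl | rfl | rfl) <;> simp_all

/-- A double arc serves both of its ends, so the third vertex only needs an arc to one end and
adjacency to the other. -/
lemma OutTriangle.of_double {S : V → Finset V} (hS : ∀ v, v ∉ S v) {a b w : V}
    (hab : b ∈ S a) (hba : a ∈ S b) (hwb : b ∈ S w) (hwa : a ∈ S w ∨ w ∈ S a) :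
    OutTriangle S {a, b, w} := by
  have h1 : a ≠ b := by rintro rfl; exact hS _ hab
  have h2 : b ≠ w := by rintro rfl; exact hS _ hwb
  have h3 : a ≠ w := by
    rintro rfl
    rcases hwa with h | h <;> exact hS _ h
  refine ⟨card_triple_eq_three_iff.2 ⟨h1, h3, h2⟩, ?_, ?_⟩
  · simp only [mem_insert, mem_singleton]
    rintro x (rfl | rfl | rfl) y (rfl | rfl | rfl) <;> simp_all
    exact hwa.symm
  · simp only [mem_insert, mem_singleton]
    rintro x (rfl | rfl | rfl) <;> simp_all

lemma sum_card_out_eq_sum_card_in (S : V → Finset V) (A B : Finset V) :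
    ∑ v ∈ A, (B ∩ S v).card = ∑ b ∈ B, (inNbrs S A b).card := by
  have := sum_card_bipartiteAbove_eq_sum_card_bipartiteBelow (s := A) (t := B)
    (fun v b => b ∈ S v)
  simpa [bipartiteAbove, bipartiteBelow, inNbrs, filter_mem_eq_inter] using this

variable [Fintype V]

lemma card_add_card_le_inter (A B : Finset V) :
    A.card + B.card ≤ (A ∩ B).card + Fintype.card V := by
  have := card_union_add_card_inter A B
  have := card_le_univ (A ∪ B)
  omega

/-- More than `|A| - n/3` vertices of `A` are out-neighbours of `b`, too many to avoid `n/3`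
in-neighbours. -/
lemma exists_double_of_inNbrs {S : V → Finset V}
    (h : ∀ v, 2 * Fintype.card V < 3 * (S v).card) {A : Finset V} {b : V}
    (hb : Fintype.card V ≤ 3 * (inNbrs S A b).card) : ∃ a ∈ A, a ∈ S b ∧ b ∈ S a := by
  by_contra! hcon
  have hdisj : Disjoint (inNbrs S A b) (A ∩ S b) := by
    rw [disjoint_left]
    intro a ha ha'
    exact hcon a (mem_of_mem_inter_left ha') (mem_of_mem_inter_right ha') (mem_inNbrs.1 ha).2
  have h1 : (inNbrs S A b).card + (A ∩ S b).card ≤ A.card := by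
    rw [← card_union_of_disjoint hdisj]
    exact card_le_card (union_subset (filter_subset _ _) inter_subset_left)
  have h2 := card_add_card_le_inter A (S b)
  have h3 := h b
  omega

/-- Averaging: in-degrees and out-degrees inside `A` have the same sum, and every out-degree inside
`A` exceeds `|A| - n/3`. -/
lemma exists_inNbrs_large {S : V → Finset V}
    (h : ∀ v, 2 * Fintype.card V < 3 * (S v).card) {A : Finset V} (hA : A.Nonempty) :
    ∃ b ∈ A, 3 * A.card < 3 * (inNbrs S A b).card + Fintype.card V := by
  by_contra! hcon
  have h1 := sum_card_out_eq_sum_card_in S A A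
  have h2 : ∑ b ∈ A, (3 * (inNbrs S A b).card + Fintype.card V) ≤ ∑ b ∈ A, 3 * A.card :=
    sum_le_sum hcon
  have h3 : ∑ v ∈ A, 3 * A.card < ∑ v ∈ A, (3 * (A ∩ S v).card + Fintype.card V) := by
    refine sum_lt_sum_of_nonempty hA fun v _ => ?_
    have := card_add_card_le_inter A (S v)
    have := h v
    omega
  simp only [sum_add_distrib, ← mul_sum, sum_const, smul_eq_mul] at h2 h3
  rw [h1] at h3
  omega

/-- A set of more than two thirds of the vertices contains a double edge whose end `b` has many
in-neighbours inside the set. -/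
lemma exists_double_edge {S : V → Finset V}
    (h : ∀ v, 2 * Fintype.card V < 3 * (S v).card) {A : Finset V}
    (hA : 2 * Fintype.card V < 3 * A.card) :
    ∃ a ∈ A, ∃ b ∈ A, a ∈ S b ∧ b ∈ S a ∧ Fintype.card V < 3 * (inNbrs S A b).card := by
  have hne : A.Nonempty := by
    rw [← card_pos]; omega
  obtain ⟨b, hb, hb'⟩ := exists_inNbrs_large h hne
  obtain ⟨a, ha, hab, hba⟩ := exists_double_of_inNbrs h (A := A) (b := b) (by omega)
  exact ⟨a, ha, b, hb, hab, hba, by omega⟩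

/-- All in-neighbours of a vertex of large in-degree are linked. -/
lemma linked_of_large_inNbrs {S : V → Finset V} (hS : ∀ v, v ∉ S v)
    (h : ∀ v, 2 * Fintype.card V < 3 * (S v).card) {b : V}
    (hb : 2 * Fintype.card V < 3 * (inNbrs S univ b).card) {x y : V}
    (hx : b ∈ S x) (hy : b ∈ S y) : Linked {T | OutTriangle S T} x y := by
  classical
  have key : ∀ x, b ∈ S x →
      3 * ((inNbrs S univ b).filter fun z => ¬ Linked {T | OutTriangle S T} z x).card
        < Fintype.card V := by
    intro x hx
    have h1 : inNbrs S (S x) b = inNbrs S univ b ∩ S x := by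
      ext; simp [mem_inNbrs, and_comm]
    have h2 := card_add_card_le_inter (inNbrs S univ b) (S x)
    rw [← h1] at h2
    have h3 := h x
    -- The double arc `ab` forms an out-triangle with `x` and with every in-neighbour of `b` in `S
    -- a`. Hence the in-neighbours not linked to `x` miss `S a`, and there are fewer than `n/3` of
    -- them.
    obtain ⟨a, ha, hab, hba⟩ := exists_double_of_inNbrs h (A := S x) (b := b) (by omega)
    have hdisj : Disjoint ((inNbrs S univ b).filter
        fun z => ¬ Linked {T | OutTriangle S T} z x) (S a) := by
      rw [disjoint_left]
      intro z hz hza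
      rw [mem_filter, mem_inNbrs] at hz
      have t1 := OutTriangle.of_double hS hba hab hz.1.2 (Or.inr hza)
      have t2 := OutTriangle.of_double hS hba hab hx (Or.inl ha)
      exact hz.2 (Linked.of_triples t1 t2 t1.1 t2.1 (Linked.refl _ _) (Linked.refl _ _))
    have h4 := card_union_of_disjoint hdisj
    have h5 := card_le_univ (((inNbrs S univ b).filter
        fun z => ¬ Linked {T | OutTriangle S T} z x) ∪ S a)
    have h6 := h a
    omega
  have hx' := key x hx
  have hy' := key y hy
  have : ∃ z ∈ inNbrs S univ b, Linked {T | OutTriangle S T} z x ∧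
      Linked {T | OutTriangle S T} z y := by
    by_contra! hcon
    have hsub : inNbrs S univ b ⊆
        ((inNbrs S univ b).filter fun z => ¬ Linked {T | OutTriangle S T} z x) ∪
        ((inNbrs S univ b).filter fun z => ¬ Linked {T | OutTriangle S T} z y) := by
      intro z hz
      by_cases hzx : Linked {T | OutTriangle S T} z x
      · exact mem_union_right _ (mem_filter.2 ⟨hz, hcon z hz hzx⟩)
      · exact mem_union_left _ (mem_filter.2 ⟨hz, hzx⟩)
    have h1 := card_le_card hsub
    have h2 := card_union_le
      ((inNbrs S univ b).filter fun z => ¬ Linked {T | OutTriangle S T} z x)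
      ((inNbrs S univ b).filter fun z => ¬ Linked {T | OutTriangle S T} z y)
    omega
  obtain ⟨z, -, hzx, hzy⟩ := this
  exact hzx.symm.trans hzy

end Digraph

/-! ### Link classes cannot be proper -/

section Digraph

/-- The count behind `eq_univ_of_no_triangle_two`: `e1` counts arcs inside `A`, and `e2` double
counts arcs inside `W`. Put `t = w - 2n/3`. Then `e1` forces `α ≤ n/3 - u/2`, hence `wm > n/3 -
u/2`, and `e2` reads `wm t + u w0 ≤ wp t`. As `wp < n/3`, it follows that `w0 < t/2` and `wm ≤ wp <
n/3`, so `w < 2n/3 + t/2 < w`. -/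
lemma closed_part_arith {n u w a α wm w0 wp : ℝ} (hw : w + u = n) (hsum : w = wm + w0 + wp)
    (hwn : 2 * n < 3 * w) (hu : 0 < u) (ha : 3 * w - n < 3 * a) (hwp : wp ≤ w - a)
    (hwm : a - α ≤ wm) (h0 : 0 ≤ w0)
    (e1 : 2 * (α * (a + 2 * n / 3 - w) + (a - α) * (a - n / 3)) ≤ a ^ 2)
    (e2 : 2 * n / 3 * (w0 + wp) + (w - n / 3) * wm ≤ wm * (n / 3) + (w - n / 3) * w0 + w * wp) :
    False := by
  obtain rfl : n = w + u := hw.symm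
  set t := w - 2 * (w + u) / 3 with ht
  have ht0 : 0 < t := by rw [ht]; linarith
  have f1 : 2 * (α * u) ≤ a * (2 * (w + u) / 3 - a) := by nlinarith
  have f2 : a * (2 * (w + u) / 3 - a) ≤ (2 * (w + u) / 3 - u) * u := by nlinarith
  have f3 : α ≤ (w + u) / 3 - u / 2 := by
    by_contra! hc
    nlinarith
  have f4 : (w + u) / 3 - u / 2 < wm := by linarith
  have f5 : wm * t + u * w0 ≤ wp * t := by nlinarith
  have f6 : w0 < t / 2 := by
    by_contra! hc
    nlinarith
  have f7 : wm ≤ wp := by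
    by_contra! hc
    nlinarith
  linarith

variable {V : Type*} [DecidableEq V]

/-- Without double arcs, the in- and out-neighbours of a vertex inside `A` are disjoint, so its two
degrees sum to at most `|A|`. -/
lemma sum_out_le_of_no_double {S : V → Finset V} {A : Finset V}
    (hA : ∀ a ∈ A, ∀ b ∈ A, a ∈ S b → b ∉ S a) : 2 * ∑ v ∈ A, (A ∩ S v).card ≤ A.card ^ 2 := by
  have h1 := sum_card_out_eq_sum_card_in S A A
  have h2 : ∑ v ∈ A, ((A ∩ S v).card + (inNbrs S A v).card) ≤ ∑ v ∈ A, A.card := by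
    refine sum_le_sum fun v hv => ?_
    rw [← card_union_of_disjoint]
    · exact card_le_card (union_subset inter_subset_left (filter_subset _ _))
    · rw [disjoint_left]
      intro z hz hz'
      rw [mem_inter] at hz
      exact hA z hz.1 v hv hz.2 (mem_inNbrs.1 hz').2
  rw [sum_add_distrib, ← h1] at h2
  simp only [sum_const, smul_eq_mul] at h2
  nlinarith

variable [Fintype V]

/-- A set of more than two thirds of the vertices that meets no out-triangle in exactly two
vertices is everything. -/
lemma eq_univ_of_no_triangle_two {S : V → Finset V} (hS : ∀ v, v ∉ S v)
    (h : ∀ v, 2 * Fintype.card V < 3 * (S v).card) {W : Finset V}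
    (hW : 2 * Fintype.card V < 3 * W.card)
    (hno : ∀ p ∈ W, ∀ q ∈ W, ∀ x, x ∉ W → ¬ OutTriangle S {p, q, x}) : W = univ := by
  classical
  by_contra hne
  obtain ⟨x, hx⟩ : ∃ x, x ∉ W := by
    by_contra! hc
    exact hne (eq_univ_iff_forall.2 hc)
  have hout : ∀ v, 3 * W.card < 3 * (W ∩ S v).card + Fintype.card V := by
    intro v
    have := card_add_card_le_inter W (S v)
    have := h v
    omega
  -- a vertex of `W` with an out-neighbour outside `W` has few in-neighbours in `W`
  have hback : ∀ b ∈ W, Fintype.card V ≤ 3 * (inNbrs S W b).card → S b ⊆ W := by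
    intro b hb hbig y hy
    by_contra hyW
    have hdisj : Disjoint (inNbrs S W b) (W ∩ S y) := by
      rw [disjoint_left]
      intro c hc hc'
      rw [mem_inNbrs] at hc
      exact hno c hc.1 b hb y hyW
        (OutTriangle.of_cycle hS hc.2 hy (mem_inter.1 hc').2)
    have h1 := card_union_of_disjoint hdisj
    have h2 : (inNbrs S W b ∪ (W ∩ S y)).card ≤ W.card :=
      card_le_card (union_subset (filter_subset _ _) inter_subset_left)
    have := hout y
    omega
  have hdouble : ∀ y, y ∉ W → ∀ b ∈ W ∩ S y, ∀ c ∈ W, c ∈ S b → b ∈ S c → c ∉ S y := by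
    intro y hy b hb c hc hbc hcb hcy
    rw [mem_inter] at hb
    exact hno c hc b hb.1 y hy (OutTriangle.of_double hS hcb hbc hb.2 (Or.inl hcy))
  -- The split follows the available bound on the in-degree inside `W`: below `n/3` on `Wm`, at most
  -- `|W| - n/3` on `W0` (see `c2`), trivial on `Wp`. By `hback`, vertices of `W0` and `Wp` have all
  -- their out-neighbours in `W`.
  set Wm := W.filter fun b => 3 * (inNbrs S W b).card < Fintype.card V with hWm
  set Wp := W.filter fun b => ¬ 3 * (inNbrs S W b).card < Fintype.card V ∧
    ∀ y, y ∉ W → b ∉ S y with hWp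
  set W0 := W.filter fun b => ¬ 3 * (inNbrs S W b).card < Fintype.card V ∧
    ¬ ∀ y, y ∉ W → b ∉ S y with hW0
  have hsplit : ∀ f : V → ℝ, ∑ b ∈ W, f b = ∑ b ∈ Wm, f b + ∑ b ∈ W0, f b + ∑ b ∈ Wp, f b := by
    intro f
    rw [← sum_filter_add_sum_filter_not W (fun b => 3 * (inNbrs S W b).card < Fintype.card V),
      ← sum_filter_add_sum_filter_not
        (W.filter fun b => ¬ 3 * (inNbrs S W b).card < Fintype.card V)
        (fun b => ∀ y, y ∉ W → b ∉ S y), filter_filter, filter_filter]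
    ring
  set A := W ∩ S x with hA
  set Am := A.filter fun b => 3 * (inNbrs S W b).card < Fintype.card V with hAm
  set Ap := A.filter fun b => ¬ 3 * (inNbrs S W b).card < Fintype.card V with hAp
  have hsplitA : ∀ f : V → ℝ, ∑ b ∈ A, f b = ∑ b ∈ Am, f b + ∑ b ∈ Ap, f b := fun f =>
    (sum_filter_add_sum_filter_not A _ f).symm
  have hcardA : (A.card : ℝ) = Am.card + Ap.card := by
    have := hsplitA fun _ => 1
    simpa using this
  have hcardW : (W.card : ℝ) = Wm.card + W0.card + Wp.card := by
    have := hsplit fun _ => 1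
    simpa using this
  have hfull : ∀ b ∈ W, ¬ 3 * (inNbrs S W b).card < Fintype.card V →
      2 * (Fintype.card V : ℝ) / 3 ≤ (W ∩ S b).card := by
    intro b hb hb'
    rw [inter_eq_right.2 (hback b hb (not_lt.1 hb'))]
    have := h b
    have : (2 * Fintype.card V : ℝ) < 3 * (S b).card := by exact_mod_cast this
    linarith
  have houtR : ∀ v, (W.card : ℝ) - Fintype.card V / 3 ≤ (W ∩ S v).card := by
    intro v
    have : (3 * W.card : ℝ) < 3 * (W ∩ S v).card + Fintype.card V := by exact_mod_cast hout v
    linarith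
  have hinter : ∀ b, ((W ∩ S b).card : ℝ) + A.card - W.card ≤ (A ∩ S b).card := by
    intro b
    have h1 := card_union_add_card_inter (W ∩ S b) A
    have h2 : ((W ∩ S b) ∪ A).card ≤ W.card :=
      card_le_card (union_subset inter_subset_left inter_subset_left)
    have h3 : (W ∩ S b) ∩ A = A ∩ S b := by
      ext z; simp only [hA, mem_inter]; tauto
    rw [h3] at h1
    have : ((W ∩ S b).card : ℝ) + A.card ≤ (A ∩ S b).card + W.card := by
      exact_mod_cast (by omega : (W ∩ S b).card + A.card ≤ (A ∩ S b).card + W.card)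
    linarith
  refine closed_part_arith (n := Fintype.card V) (u := (Wᶜ).card) (w := W.card) (a := A.card)
    (α := Ap.card) (wm := Wm.card) (w0 := W0.card) (wp := Wp.card) ?_ hcardW ?_ ?_ ?_ ?_ ?_
    (by positivity) ?_ ?_
  · exact_mod_cast card_add_card_compl W
  · exact_mod_cast hW
  · exact_mod_cast card_pos.2 ⟨x, mem_compl.2 hx⟩
  · have : (3 * W.card : ℝ) < 3 * A.card + Fintype.card V := by exact_mod_cast hout x
    linarith
  · have hdisj : Disjoint Wp A := by
      rw [disjoint_left]
      intro b hb hb'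
      exact (mem_filter.1 hb).2.2 x hx (mem_inter.1 hb').2
    have h1 := card_union_of_disjoint hdisj
    have h2 : (Wp ∪ A).card ≤ W.card :=
      card_le_card (union_subset (filter_subset _ _) inter_subset_left)
    have : (Wp.card : ℝ) + A.card ≤ W.card := by
      exact_mod_cast (by omega : Wp.card + A.card ≤ W.card)
    linarith
  · have : (Am.card : ℝ) ≤ Wm.card := by
      exact_mod_cast card_le_card (filter_subset_filter _ inter_subset_left)
    linarith
  · have h1 := sum_out_le_of_no_double (S := S) (A := A) (by
      intro a ha b hb hab hba
      exact hdouble x hx b hb a (mem_inter.1 ha).1 hab hba (mem_inter.1 ha).2)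
    have h2 : (2 * ∑ v ∈ A, ((A ∩ S v).card : ℝ)) ≤ (A.card : ℝ) ^ 2 := by exact_mod_cast h1
    rw [hsplitA] at h2
    have h3 : ∑ b ∈ Am, ((A.card : ℝ) - Fintype.card V / 3) ≤ ∑ b ∈ Am, ((A ∩ S b).card : ℝ) := by
      refine sum_le_sum fun b _ => ?_
      have := hinter b
      have := houtR b
      linarith
    have h4 : ∑ b ∈ Ap, ((A.card : ℝ) + 2 * Fintype.card V / 3 - W.card) ≤
        ∑ b ∈ Ap, ((A ∩ S b).card : ℝ) := by
      refine sum_le_sum fun b hb => ?_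
      rw [hAp, mem_filter] at hb
      have := hinter b
      have := hfull b (mem_inter.1 hb.1).1 hb.2
      linarith
    rw [sum_const, nsmul_eq_mul] at h3 h4
    have h5 : (A.card : ℝ) - Ap.card = Am.card := by linarith
    rw [h5]
    linarith
  · have h1 : ∑ v ∈ W, ((W ∩ S v).card : ℝ) = ∑ b ∈ W, ((inNbrs S W b).card : ℝ) := by
      exact_mod_cast sum_card_out_eq_sum_card_in S W W
    rw [hsplit, hsplit] at h1
    have b1 : ∑ b ∈ Wm, ((W.card : ℝ) - Fintype.card V / 3) ≤ ∑ b ∈ Wm, ((W ∩ S b).card : ℝ) :=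
      sum_le_sum fun b _ => houtR b
    have b2 : ∑ b ∈ W0, (2 * (Fintype.card V : ℝ) / 3) ≤ ∑ b ∈ W0, ((W ∩ S b).card : ℝ) :=
      sum_le_sum fun b hb => hfull b (mem_filter.1 hb).1 (mem_filter.1 hb).2.1
    have b3 : ∑ b ∈ Wp, (2 * (Fintype.card V : ℝ) / 3) ≤ ∑ b ∈ Wp, ((W ∩ S b).card : ℝ) :=
      sum_le_sum fun b hb => hfull b (mem_filter.1 hb).1 (mem_filter.1 hb).2.1
    have c1 : ∑ b ∈ Wm, ((inNbrs S W b).card : ℝ) ≤ ∑ b ∈ Wm, ((Fintype.card V : ℝ) / 3) := by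
      refine sum_le_sum fun b hb => ?_
      have : (3 * (inNbrs S W b).card : ℝ) < Fintype.card V := by
        exact_mod_cast (mem_filter.1 hb).2
      linarith
    have c2 : ∑ b ∈ W0, ((inNbrs S W b).card : ℝ) ≤
        ∑ b ∈ W0, ((W.card : ℝ) - Fintype.card V / 3) := by
      refine sum_le_sum fun b hb => ?_
      rw [hW0, mem_filter] at hb
      obtain ⟨hbW, hbig, hhit⟩ := hb
      push Not at hhit
      obtain ⟨y, hy, hyb⟩ := hhit
      -- The in- and out-neighbours of `b` overlap in its double arcs. By `hdouble` the overlap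
      -- misses `W ∩ S y`, so it has at most `n/3` vertices.
      have g1 := card_union_add_card_inter (inNbrs S W b) (W ∩ S b)
      have g2 : (inNbrs S W b ∪ (W ∩ S b)).card ≤ W.card :=
        card_le_card (union_subset (filter_subset _ _) inter_subset_left)
      have hdisj : Disjoint (inNbrs S W b ∩ (W ∩ S b)) (W ∩ S y) := by
        rw [disjoint_left]
        intro c hc hc'
        rw [mem_inter, mem_inNbrs, mem_inter] at hc
        exact hdouble y hy b (mem_inter.2 ⟨hbW, hyb⟩) c hc.1.1 hc.2.2 hc.1.2 (mem_inter.1 hc').2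
      have g3 := card_union_of_disjoint hdisj
      have g4 : (inNbrs S W b ∩ (W ∩ S b) ∪ (W ∩ S y)).card ≤ W.card :=
        card_le_card (union_subset (inter_subset_right.trans inter_subset_left) inter_subset_left)
      have g5 := hfull b hbW hbig
      have g6 := houtR y
      have g7 : ((inNbrs S W b).card : ℝ) + (W ∩ S b).card + (W ∩ S y).card ≤
          W.card + W.card := by
        exact_mod_cast (by omega : (inNbrs S W b).card + (W ∩ S b).card + (W ∩ S y).card ≤
          W.card + W.card)
      linarith
    have c3 : ∑ b ∈ Wp, ((inNbrs S W b).card : ℝ) ≤ ∑ b ∈ Wp, (W.card : ℝ) :=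
      sum_le_sum fun b _ => by exact_mod_cast card_le_card (filter_subset _ _)
    rw [sum_const, nsmul_eq_mul] at b1 b2 b3
    rw [sum_const (s := Wm), nsmul_eq_mul] at c1
    rw [sum_const (s := W0), nsmul_eq_mul] at c2
    rw [sum_const (s := Wp), nsmul_eq_mul] at c3
    linarith

/-- If all out-degrees exceed two thirds of the order, the lattice of out-triangles contains the
difference of any two unit vectors. -/
theorem linked_of_outDegree {S : V → Finset V} (hS : ∀ v, v ∉ S v)
    (h : ∀ v, 2 * Fintype.card V < 3 * (S v).card) (x y : V) :
    Linked {T | OutTriangle S T} x y := by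
  classical
  obtain ⟨b, -, hb⟩ := exists_inNbrs_large h (A := univ) ⟨x, mem_univ x⟩
  rw [card_univ] at hb
  obtain ⟨z, hz⟩ : (inNbrs S univ b).Nonempty := by
    rw [← card_pos]; omega
  set W : Finset V := univ.filter fun v => Linked {T | OutTriangle S T} v z with hWdef
  have hlink : ∀ p ∈ W, ∀ q ∈ W, Linked {T | OutTriangle S T} p q := by
    intro p hp q hq
    exact (mem_filter.1 hp).2.trans (mem_filter.1 hq).2.symm
  have hsub : inNbrs S univ b ⊆ W := fun v hv => mem_filter.2 ⟨mem_univ v,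
    linked_of_large_inNbrs hS h (by omega) (mem_inNbrs.1 hv).2 (mem_inNbrs.1 hz).2⟩
  have hW : 2 * Fintype.card V < 3 * W.card := by
    have := card_le_card hsub
    omega
  -- Some out-triangle lies entirely in the link class `W`. Comparison with it pulls the third
  -- vertex of any out-triangle with two vertices in `W` into the class.
  obtain ⟨a, ha, d, hd, had, hda, hin⟩ := exists_double_edge h hW
  obtain ⟨c, hc⟩ : (inNbrs S W d ∩ S a).Nonempty := by
    rw [← card_pos]
    have := card_add_card_le_inter (inNbrs S W d) (S a)
    have := h a
    omega
  rw [mem_inter, mem_inNbrs] at hc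
  have ht := OutTriangle.of_double hS hda had hc.1.2 (Or.inr hc.2)
  have huniv : W = univ := by
    refine eq_univ_of_no_triangle_two hS h hW fun p hp q hq v hv ht' => hv ?_
    have := Linked.of_triples ht' ht ht'.1 ht.1 (hlink p hp a ha) (hlink q hq d hd)
    exact mem_filter.2 ⟨mem_univ v, this.trans (mem_filter.1 hc.1.1).2⟩
  exact hlink x (huniv ▸ mem_univ x) y (huniv ▸ mem_univ y)

end Digraph

/-! ### Counting tuples: blow-ups and tail bounds -/

section Counting

/-- Coordinates outside the range of `f` are free, so a condition on the coordinates in the range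
keeps its density. -/
lemma card_filter_comp {α β V : Type*} [Fintype α] [Fintype β] [Fintype V] [DecidableEq α]
    [DecidableEq β] [DecidableEq V] {f : α → β} (hf : Function.Injective f)
    (P : Finset (α → V)) :
    (univ.filter fun v : β → V => v ∘ f ∈ P).card * Fintype.card V ^ Fintype.card α =
      P.card * Fintype.card V ^ Fintype.card β := by
  classical
  let e : α ⊕ {b // b ∉ Set.range f} ≃ β :=
    ((Equiv.ofInjective f hf).sumCongr (Equiv.refl _)).trans (Equiv.Set.sumCompl (Set.range f))
  let E : (β → V) ≃ (α → V) × ({b // b ∉ Set.range f} → V) :=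
    (e.symm.arrowCongr (Equiv.refl V)).trans (Equiv.sumArrowEquivProdArrow _ _ _)
  have hE : ∀ v, (E v).1 = v ∘ f := by
    intro v
    funext a
    change v (Equiv.Set.sumCompl (Set.range f) (Sum.inl ⟨f a, Set.mem_range_self a⟩)) = v (f a)
    rw [Equiv.Set.sumCompl_apply_inl]
  have h1 : (univ.filter fun v : β → V => v ∘ f ∈ P).card =
      (P ×ˢ (univ : Finset ({b // b ∉ Set.range f} → V))).card := by
    refine card_equiv E fun v => ?_
    simp [hE]
  have hcard : Fintype.card β = Fintype.card α + Fintype.card {b // b ∉ Set.range f} := by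
    rw [← Fintype.card_congr e, Fintype.card_sum]
  rw [h1, card_product, card_univ, Fintype.card_fun, hcard, pow_add]
  ring

lemma avg_pow_le {ι : Type*} [Fintype ι] [Nonempty ι] {f : ι → ℝ} (hf : ∀ i, 0 ≤ f i) (p : ℕ) :
    ((∑ i, f i) / Fintype.card ι) ^ p ≤ (∑ i, f i ^ p) / Fintype.card ι := by
  have hpos : (0 : ℝ) < Fintype.card ι := by exact_mod_cast Fintype.card_pos
  have := Real.pow_arith_mean_le_arith_mean_pow univ (fun _ => (1 : ℝ) / Fintype.card ι) f
    (fun _ _ => by positivity) (by simp [hpos.ne']) (fun i _ => hf i) p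
  simp only [← mul_sum, one_div] at this
  rw [div_eq_inv_mul, div_eq_inv_mul]
  exact this

/-- The tuples of `k` blocks of `t` entries all of whose transversals lie in `Q`. -/
def blowUp {V : Type*} [Fintype V] [DecidableEq V] {k : ℕ} (Q : Finset (Fin k → V)) (t : ℕ) :
    Finset (Fin k → Fin t → V) :=
  univ.filter fun w => ∀ s : Fin k → Fin t, (fun i => w i (s i)) ∈ Q

/-- A family of `k`-tuples of positive density has a blow-up of positive density. -/
lemma density_blowUp {V : Type*} [Fintype V] [DecidableEq V] [Nonempty V] (t : ℕ) :
    ∀ (k : ℕ) (Q : Finset (Fin k → V)),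
      ((Q.card : ℝ) / (Fintype.card V : ℝ) ^ k) ^ (t ^ k) ≤
        ((blowUp Q t).card : ℝ) / ((Fintype.card V : ℝ) ^ t) ^ k := by
  have hn : (0 : ℝ) < Fintype.card V := by exact_mod_cast Fintype.card_pos
  intro k
  induction k with
  | zero =>
    intro Q
    have h : Q.card ≤ (blowUp Q t).card := by
      refine card_le_card_of_injOn (fun _ => Fin.elim0) (fun v hv => ?_) (fun v _ w _ _ => ?_)
      · simp only [blowUp, coe_filter, mem_univ, true_and, Set.mem_ofPred_eq]
        intro s
        rwa [Subsingleton.elim (fun i : Fin 0 => (Fin.elim0 i : Fin t → V) (s i)) v]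
      · exact Subsingleton.elim _ _
    simpa using (by exact_mod_cast h : (Q.card : ℝ) ≤ (blowUp Q t).card)
  | succ k ih =>
    intro Q
    let Qu : (Fin t → V) → Finset (Fin k → V) := fun u =>
      univ.filter fun v => ∀ j, (Fin.cons (u j) v : Fin (k + 1) → V) ∈ Q
    let c : (Fin k → V) → Finset V := fun v => univ.filter fun a =>
      (Fin.cons a v : Fin (k + 1) → V) ∈ Q
    have hQ : (Q.card : ℝ) = ∑ v, ((c v).card : ℝ) := by
      have : Q.card = ((univ : Finset (Fin k → V)).sigma c).card := by
        refine card_bij' (fun v _ => ⟨Fin.tail v, v 0⟩) (fun x _ => Fin.cons x.2 x.1) ?_ ?_ ?_ ?_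
        · intro v hv
          simpa [c] using hv
        · rintro ⟨v, a⟩ h
          simpa [c] using h
        · intro v hv
          simp
        · rintro ⟨v, a⟩ h
          simp
      rw [this, card_sigma]
      push_cast
      rfl
    have hB : ((blowUp Q t).card : ℝ) = ∑ u, ((blowUp (Qu u) t).card : ℝ) := by
      have : (blowUp Q t).card =
          ((univ : Finset (Fin t → V)).sigma fun u => blowUp (Qu u) t).card := by
        refine card_bij' (fun w _ => ⟨w 0, Fin.tail w⟩)
          (fun x _ => (Fin.cons x.1 x.2 : Fin (k + 1) → Fin t → V)) ?_ ?_ ?_ ?_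
        · intro w hw
          simp only [blowUp, mem_filter, mem_univ, true_and, mem_sigma, Qu] at hw ⊢
          intro s j
          convert hw (Fin.cons j s) using 1
          funext i
          refine Fin.cases ?_ (fun i => ?_) i <;> simp [Fin.tail]
        · rintro ⟨u, w⟩ h
          simp only [blowUp, mem_filter, mem_univ, true_and, mem_sigma, Qu] at h ⊢
          intro s
          convert h (Fin.tail s) (s 0) using 1
          funext i
          refine Fin.cases ?_ (fun i => ?_) i <;> simp [Fin.tail]
        · intro w _
          simp
        · rintro ⟨u, w⟩ _
          simp
      rw [this, card_sigma]
      push_cast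
      rfl
    have hcount : ∑ u, ((Qu u).card : ℝ) = ∑ v, ((c v).card : ℝ) ^ t := by
      have h1 := sum_card_bipartiteAbove_eq_sum_card_bipartiteBelow
        (s := (univ : Finset (Fin t → V))) (t := (univ : Finset (Fin k → V)))
        (fun u v => ∀ j, (Fin.cons (u j) v : Fin (k + 1) → V) ∈ Q)
      have h2 : ∀ v : Fin k → V, ((univ : Finset (Fin t → V)).bipartiteBelow
          (fun u v => ∀ j, (Fin.cons (u j) v : Fin (k + 1) → V) ∈ Q) v).card =
          (c v).card ^ t := by
        intro v
        have : (univ : Finset (Fin t → V)).bipartiteBelow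
          (fun u v => ∀ j, (Fin.cons (u j) v : Fin (k + 1) → V) ∈ Q) v =
            Fintype.piFinset fun _ => c v := by
          ext u
          simp [bipartiteBelow, c]
        rw [this, Fintype.card_piFinset]
        simp
      simp only [h2] at h1
      exact_mod_cast h1
    -- Two power means: `a1`, over the last `k` coordinates, passes to `t` copies of the first one;
    -- `a2`, over those copies, leads to the induction hypothesis.
    have a1 := avg_pow_le (f := fun v : Fin k → V => ((c v).card : ℝ)) (fun _ => by positivity) t
    have a2 := avg_pow_le (f := fun u : Fin t → V => ((Qu u).card : ℝ) / (Fintype.card V : ℝ) ^ k)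
      (fun _ => by positivity) (t ^ k)
    simp only [Fintype.card_fun, Fintype.card_fin, Nat.cast_pow] at a1 a2
    rw [← hcount, ← hQ] at a1
    have a3 : (∑ u, (((Qu u).card : ℝ) / (Fintype.card V : ℝ) ^ k) ^ (t ^ k)) /
        (Fintype.card V : ℝ) ^ t ≤ ((blowUp Q t).card : ℝ) / ((Fintype.card V : ℝ) ^ t) ^ (k + 1) := by
      rw [hB, pow_succ ((Fintype.card V : ℝ) ^ t) k, ← div_div]
      refine div_le_div_of_nonneg_right ?_ (by positivity)
      rw [sum_div]
      exact sum_le_sum fun u _ => ih (Qu u)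
    refine le_trans ?_ (a2.trans a3)
    rw [pow_succ' t k, pow_mul]
    refine pow_le_pow_left₀ (by positivity) ?_ _
    rw [← sum_div, div_right_comm]
    calc ((Q.card : ℝ) / (Fintype.card V : ℝ) ^ (k + 1)) ^ t
        = ((Q.card : ℝ) / (Fintype.card V : ℝ) ^ k) ^ t / (Fintype.card V : ℝ) ^ t := by
          rw [pow_succ, ← div_div, div_pow]
      _ ≤ (∑ u, ((Qu u).card : ℝ)) / (Fintype.card V : ℝ) ^ k / (Fintype.card V : ℝ) ^ t := by
          gcongr
      _ = _ := by rw [div_right_comm]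

/-- Exponential tail bound for the number of coordinates of a random tuple that lie in `C`. -/
lemma card_tail_le {J V : Type*} [Fintype J] [Fintype V] [DecidableEq J] [DecidableEq V]
    (C : Finset V) {p s r : ℝ} (hp : (C.card : ℝ) ≤ p * Fintype.card V) (hs : 0 ≤ s)
    (hs1 : s ≤ 1) :
    (((univ : Finset (J → V)).filter fun v =>
        r ≤ ((univ.filter fun j => v j ∈ C).card : ℝ)).card : ℝ) ≤
      (Fintype.card V : ℝ) ^ Fintype.card J *
        Real.exp (p * (s + s ^ 2) * Fintype.card J - s * r) := by
  -- Markov's inequality for `exp (s * count)`, whose sum factorises over the coordinates; `exp s ≤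
  -- 1 + s + s ^ 2` bounds each factor.
  let g : V → ℝ := fun u => if u ∈ C then Real.exp s else 1
  have hg : ∀ u, 0 < g u := by
    intro u
    simp only [g]
    split_ifs <;> positivity
  have hprod : ∀ v : J → V,
      ∏ j, g (v j) = Real.exp (s * ((univ.filter fun j => v j ∈ C).card : ℝ)) := by
    intro v
    simp only [g]
    rw [prod_ite, prod_const, prod_const_one, mul_one, ← Real.exp_nat_mul, mul_comm]
  have h1 : (((univ : Finset (J → V)).filter fun v =>
        r ≤ ((univ.filter fun j => v j ∈ C).card : ℝ)).card : ℝ) ≤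
      ∑ v : J → V, Real.exp (-(s * r)) * ∏ j, g (v j) := by
    rw [card_filter]
    push_cast
    refine sum_le_sum fun v _ => ?_
    rw [hprod, ← Real.exp_add]
    split_ifs with h
    · rw [← Real.exp_zero]
      apply Real.exp_le_exp.2
      have := mul_le_mul_of_nonneg_left h hs
      linarith
    · positivity
  have h2 : ∑ v : J → V, ∏ j, g (v j) = (∑ u, g u) ^ Fintype.card J := by
    have := prod_univ_sum (fun _ : J => (univ : Finset V)) (fun _ u => g u)
    rw [Fintype.piFinset_univ] at this
    rw [← this, prod_const, card_univ]
  have h3 : ∑ u, g u ≤ Fintype.card V * Real.exp (p * (s + s ^ 2)) := by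
    have e1 : Real.exp s ≤ 1 + s + s ^ 2 := by
      have := Real.abs_exp_sub_one_sub_id_le (x := s) (by rw [abs_of_nonneg hs]; exact hs1)
      have := (abs_le.1 this).2
      linarith
    have e2 : ∑ u, g u = Fintype.card V + C.card * (Real.exp s - 1) := by
      have : ∀ u, g u = 1 + if u ∈ C then Real.exp s - 1 else 0 := by
        intro u
        simp only [g]
        split_ifs <;> ring
      simp only [this, sum_add_distrib, sum_ite_mem, univ_inter, sum_const, nsmul_eq_mul, mul_one,
        card_univ]
    have e3 : (C.card : ℝ) * (Real.exp s - 1) ≤ p * Fintype.card V * (s + s ^ 2) := by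
      refine mul_le_mul hp (by linarith) ?_ (le_trans (by positivity) hp)
      have := Real.add_one_le_exp s
      linarith
    have e4 := Real.add_one_le_exp (p * (s + s ^ 2))
    rw [e2]
    nlinarith [mul_le_mul_of_nonneg_left e4 (Nat.cast_nonneg (α := ℝ) (Fintype.card V))]
  rw [← mul_sum, h2] at h1
  refine h1.trans ?_
  have h4 : (∑ u, g u) ^ Fintype.card J ≤
      (Fintype.card V * Real.exp (p * (s + s ^ 2))) ^ Fintype.card J :=
    pow_le_pow_left₀ (sum_nonneg fun u _ => (hg u).le) h3 _
  rw [mul_pow, ← Real.exp_nat_mul] at h4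
  calc Real.exp (-(s * r)) * (∑ u, g u) ^ Fintype.card J
      ≤ Real.exp (-(s * r)) * ((Fintype.card V : ℝ) ^ Fintype.card J *
          Real.exp (Fintype.card J * (p * (s + s ^ 2)))) := by gcongr
    _ = _ := by
      rw [mul_left_comm, ← Real.exp_add]
      congr 2
      ring

/-- Tail bound for the number of coordinates that avoid the out-neighbourhood of coordinate `i`. -/
lemma card_out_tail_le {V : Type*} [Fintype V] [DecidableEq V] {M : ℕ} (i : Fin M)
    (C : V → Finset V) {p s r : ℝ} (hp : ∀ u, ((C u).card : ℝ) ≤ p * Fintype.card V)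
    (hp0 : 0 ≤ p) (hs : 0 ≤ s) (hs1 : s ≤ 1) :
    (((univ : Finset (Fin M → V)).filter fun v =>
        r + 1 ≤ ((univ.filter fun j => v j ∈ C (v i)).card : ℝ)).card : ℝ) ≤
      (Fintype.card V : ℝ) ^ M * Real.exp (p * (s + s ^ 2) * M - s * r) := by
  classical
  -- Fixing `v i` leaves the other coordinates free. The threshold `r + 1` allows for coordinate `i`
  -- itself being counted.
  let e := Equiv.funSplitAt i V
  let B : V → Finset ({j // j ≠ i} → V) := fun u => univ.filter fun v =>
    r ≤ ((univ.filter fun j => v j ∈ C u).card : ℝ)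
  have h1 : ((univ : Finset (Fin M → V)).filter fun v =>
      r + 1 ≤ ((univ.filter fun j => v j ∈ C (v i)).card : ℝ)).card ≤
      ((univ : Finset V).sigma B).card := by
    refine card_le_card_of_injOn (fun v => ⟨(e v).1, (e v).2⟩) ?_ ?_
    · intro v hv
      simp only [coe_filter, mem_univ, true_and, Set.mem_ofPred_eq] at hv
      simp only [coe_sigma, Set.mem_sigma_iff, coe_univ, Set.mem_univ, true_and, B, coe_filter,
        mem_univ, Set.mem_ofPred_eq]
      have : (univ.filter fun j => v j ∈ C (v i)).card ≤
          (univ.filter fun j : {j // j ≠ i} => (e v).2 j ∈ C (e v).1).card + 1 := by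
        have hsub : (univ.filter fun j => v j ∈ C (v i)) ⊆
            insert i ((univ.filter fun j : {j // j ≠ i} => (e v).2 j ∈ C (e v).1).map
              (Function.Embedding.subtype _)) := by
          intro j hj
          by_cases hji : j = i
          · simp [hji]
          · refine mem_insert_of_mem (mem_map.2 ⟨⟨j, hji⟩, ?_, rfl⟩)
            simpa [e] using hj
        refine (card_le_card hsub).trans ((card_insert_le _ _).trans ?_)
        rw [card_map]
      have : ((univ.filter fun j => v j ∈ C (v i)).card : ℝ) ≤
          (univ.filter fun j : {j // j ≠ i} => (e v).2 j ∈ C (e v).1).card + 1 := by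
        exact_mod_cast this
      linarith
    · intro v _ w _ hvw
      apply e.injective
      simp only [Sigma.mk.injEq, heq_eq_eq] at hvw
      exact Prod.ext hvw.1 hvw.2
  have hcard : Fintype.card {j // j ≠ i} = M - 1 := by
    simp
  have hM : 0 < M := i.pos
  have h2 : ∀ u, ((B u).card : ℝ) ≤ (Fintype.card V : ℝ) ^ (M - 1) *
      Real.exp (p * (s + s ^ 2) * M - s * r) := by
    intro u
    refine (card_tail_le (J := {j // j ≠ i}) (C u) (hp u) hs hs1).trans ?_
    rw [hcard]
    have : ((M - 1 : ℕ) : ℝ) ≤ M := by exact_mod_cast Nat.sub_le _ _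
    gcongr
  calc _ ≤ (((univ : Finset V).sigma B).card : ℝ) := by exact_mod_cast h1
    _ = ∑ u, ((B u).card : ℝ) := by rw [card_sigma]; push_cast; rfl
    _ ≤ ∑ u : V, (Fintype.card V : ℝ) ^ (M - 1) *
      Real.exp (p * (s + s ^ 2) * M - s * r) := sum_le_sum fun u _ => h2 u
    _ = _ := by
      rw [sum_const, card_univ, nsmul_eq_mul, ← mul_assoc, ← pow_succ', Nat.sub_add_cancel hM]

end Counting

/-! ### Assembling perfect tilings -/

section Tiling

variable {V K : Type*} {G : SimpleGraph V} {c : G.EdgeLabeling K}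

lemma HasPerfectRainbowTiling.empty {r : ℕ} : HasPerfectRainbowTiling c r ∅ :=
  ⟨∅, by simp, by simp, by simp⟩

lemma IsRainbowClique.hasPerfectRainbowTiling {r : ℕ} {T : Finset V}
    (hT : IsRainbowClique c r T) : HasPerfectRainbowTiling c r T :=
  ⟨{T}, by simpa using hT, by simp, by simp⟩

variable [DecidableEq V]

lemma HasPerfectRainbowTiling.union {r : ℕ} {S T : Finset V}
    (hS : HasPerfectRainbowTiling c r S) (hT : HasPerfectRainbowTiling c r T)
    (hST : Disjoint S T) : HasPerfectRainbowTiling c r (S ∪ T) := by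
  classical
  obtain ⟨P, hP1, hP2, hP3⟩ := hS
  obtain ⟨Q, hQ1, hQ2, hQ3⟩ := hT
  have hcross : ∀ A ∈ P, ∀ B ∈ Q, Disjoint A B := by
    intro A hA B hB
    rw [disjoint_left]
    intro v hvA hvB
    exact disjoint_left.1 hST ((hP3 v).2 ⟨A, hA, hvA⟩) ((hQ3 v).2 ⟨B, hB, hvB⟩)
  refine ⟨P ∪ Q, ?_, ?_, ?_⟩
  · intro A hA
    rcases mem_union.1 hA with h | h
    exacts [hP1 A h, hQ1 A h]
  · intro A hA B hB hAB
    rcases mem_union.1 hA with h | h <;> rcases mem_union.1 hB with h' | h'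
    exacts [hP2 A h B h' hAB, hcross A h B h', (hcross B h' A h).symm, hQ2 A h B h' hAB]
  · intro v
    simp only [mem_union, hP3, hQ3, or_and_right, exists_or]

/-- If the numbers of clones agree with the multiplicities of a list of index sets, then the
clones can be grouped into copies of these index sets, completed by the prescribed extra sets. -/
lemma hasPerfectRainbowTiling_of_pieces {I ι : Type*} [DecidableEq I] [DecidableEq ι]
    (κ : I → ι) (u : I → V) {r : ℕ} (L : List (Finset ι × Finset V)) :
    ∀ (J : Finset I) (Z : Finset V), Set.InjOn u J →
      (∀ i, (J.filter fun α => κ α = i).card = L.countP fun q => i ∈ q.1) →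
      (∀ q ∈ L, ∀ B ⊆ J, Set.InjOn κ B → B.image κ = q.1 →
        IsRainbowClique c r (B.image u ∪ q.2)) →
      L.Pairwise (fun q q' => Disjoint q.2 q'.2) →
      (∀ q ∈ L, Disjoint q.2 (J.image u)) →
      (∀ v, v ∈ Z ↔ v ∈ J.image u ∨ ∃ q ∈ L, v ∈ q.2) →
      HasPerfectRainbowTiling c r Z := by
  induction L with
  | nil =>
    intro J Z _ hcount _ _ _ hZ
    have hJ : J = ∅ := by
      rw [eq_empty_iff_forall_notMem]
      intro α hα
      have := hcount (κ α)
      rw [List.countP_nil, card_eq_zero, filter_eq_empty_iff] at this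
      exact this hα rfl
    have : Z = ∅ := by
      rw [eq_empty_iff_forall_notMem]
      intro v hv
      simp [hZ, hJ] at hv
    rw [this]
    exact HasPerfectRainbowTiling.empty
  | cons q L ih =>
    intro J Z hu hcount hpiece hpair hdisj hZ
    have hsurj : Set.SurjOn κ J q.1 := by
      intro i hi
      have h1 := hcount i
      rw [List.countP_cons_of_pos (by simpa using hi)] at h1
      obtain ⟨α, hα⟩ : (J.filter fun α => κ α = i).Nonempty := by
        rw [← card_pos]; omega
      rw [mem_filter] at hα
      exact ⟨α, hα.1, hα.2⟩
    -- One unused clone of each index in `q.1` is spent on the first piece. The clone counts drop by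
    -- one exactly on `q.1`, so the induction continues with `J \ B`.
    obtain ⟨B, hBJ, hBinj, hBim⟩ : ∃ B ⊆ J, Set.InjOn κ B ∧ B.image κ = q.1 := by
      obtain ⟨B, hBJ, hBinj, hBim⟩ := hsurj.exists_subset_injOn_image_eq
      have hfin : B.Finite := J.finite_toSet.subset hBJ
      refine ⟨hfin.toFinset, by simpa using hBJ, by simpa using hBinj, ?_⟩
      rw [← coe_inj, coe_image, Set.Finite.coe_toFinset, hBim]
    have hBcount : ∀ i, (B.filter fun α => κ α = i).card = if i ∈ q.1 then 1 else 0 := by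
      intro i
      split_ifs with hi
      · rw [← hBim, mem_image] at hi
        obtain ⟨α, hα, rfl⟩ := hi
        rw [card_eq_one]
        refine ⟨α, ?_⟩
        ext β
        simp only [mem_filter, mem_singleton]
        exact ⟨fun h => hBinj h.1 hα h.2, by rintro rfl; exact ⟨hα, rfl⟩⟩
      · rw [card_eq_zero, filter_eq_empty_iff]
        rintro α hα rfl
        exact hi (hBim ▸ mem_image_of_mem κ hα)
    have himdisj : Disjoint (B.image u) ((J \ B).image u) := by
      rw [disjoint_left]
      intro v hv hv'
      obtain ⟨α, hα, rfl⟩ := mem_image.1 hv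
      obtain ⟨β, hβ, hβα⟩ := mem_image.1 hv'
      rw [mem_sdiff] at hβ
      exact hβ.2 (hu hβ.1 (hBJ hα) hβα ▸ hα)
    have himJ : ∀ v, v ∈ J.image u ↔ v ∈ B.image u ∨ v ∈ (J \ B).image u := by
      intro v
      rw [← mem_union, ← image_union, union_sdiff_of_subset hBJ]
    let Z' := Z \ (B.image u ∪ q.2)
    rw [List.pairwise_cons] at hpair
    have hrest : HasPerfectRainbowTiling c r Z' := by
      refine ih (J \ B) Z' (hu.mono (by simp)) ?_ ?_ hpair.2 ?_ ?_
      · intro i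
        have h1 := hcount i
        have h2 := hBcount i
        have h3 : (J.filter fun α => κ α = i).card =
            ((J \ B).filter fun α => κ α = i).card + (B.filter fun α => κ α = i).card := by
          rw [← card_union_of_disjoint, ← filter_union, sdiff_union_of_subset hBJ]
          exact disjoint_filter_filter sdiff_disjoint
        rw [List.countP_cons] at h1
        simp only [decide_eq_true_eq] at h1
        omega
      · intro q' hq' B' hB'
        exact hpiece q' (List.mem_cons_of_mem _ hq') B' (hB'.trans sdiff_subset)
      · intro q' hq'
        exact (hdisj q' (List.mem_cons_of_mem _ hq')).mono_right (image_subset_image sdiff_subset)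
      · intro v
        simp only [Z', mem_sdiff, mem_union, hZ, himJ, List.mem_cons, exists_eq_or_imp]
        have d1 : v ∈ B.image u → v ∉ (J \ B).image u := fun h => disjoint_left.1 himdisj h
        have d2 : v ∈ q.2 → v ∉ (J \ B).image u := fun h h' =>
          disjoint_left.1 (hdisj q List.mem_cons_self) h ((himJ v).2 (Or.inr h'))
        have d3 : v ∈ q.2 → ¬ ∃ q' ∈ L, v ∈ q'.2 := by
          rintro h ⟨q', hq', h'⟩
          exact disjoint_left.1 (hpair.1 q' hq') h h'
        have d4 : v ∈ B.image u → ¬ ∃ q' ∈ L, v ∈ q'.2 := by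
          rintro h ⟨q', hq', h'⟩
          exact disjoint_left.1 (hdisj q' (List.mem_cons_of_mem _ hq')) h'
            ((himJ v).2 (Or.inl h))
        constructor
        · rintro ⟨(h | h) | h | h, hn⟩
          exacts [(hn (Or.inl h)).elim, Or.inl h, (hn (Or.inr h)).elim, Or.inr h]
        · rintro (h | h)
          · exact ⟨Or.inl (Or.inr h), fun h' => h'.elim (fun h' => d1 h' h) fun h' => d2 h' h⟩
          · exact ⟨Or.inr (Or.inr h), fun h' => h'.elim (fun h' => d4 h' h) fun h' => d3 h' h⟩
    have hq : IsRainbowClique c r (B.image u ∪ q.2) :=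
      hpiece q List.mem_cons_self B hBJ hBinj hBim
    have hsub : B.image u ∪ q.2 ⊆ Z := by
      intro v hv
      rw [hZ, himJ]
      rcases mem_union.1 hv with h | h
      · exact Or.inl (Or.inl h)
      · exact Or.inr ⟨q, List.mem_cons_self, h⟩
    have := hrest.union hq.hasPerfectRainbowTiling sdiff_disjoint
    rwa [sdiff_union_of_subset hsub] at this

end Tiling

/-! ### From lattice membership to multiplicities -/

section Multiplicities

variable {ι : Type*} [DecidableEq ι]

lemma indicatorVec_apply (e : Finset ι) (i : ι) : indicatorVec e i = if i ∈ e then 1 else 0 := by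
  simp [indicatorVec, Finset.sum_apply, Pi.single_apply]

lemma sum_indicatorVec_apply (P : List (Finset ι)) (i : ι) :
    (P.map indicatorVec).sum i = (P.countP fun e => i ∈ e : ℕ) := by
  induction P with
  | nil => simp
  | cons e P ih =>
    rw [List.map_cons, List.sum_cons, Pi.add_apply, ih, indicatorVec_apply, List.countP_cons]
    by_cases h : i ∈ e <;> simp [h, add_comm]

/-- Positive and negative coefficients go to separate lists, because tilings need nonnegative
multiplicities. -/
lemma exists_lists_of_mem_spanLattice {E : Set (Finset ι)} {f : ι → ℤ} (hf : f ∈ spanLattice E) :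
    ∃ P Q : List (Finset ι), (∀ e ∈ P, e ∈ E) ∧ (∀ e ∈ Q, e ∈ E) ∧
      f + (Q.map indicatorVec).sum = (P.map indicatorVec).sum := by
  induction hf using AddSubgroup.closure_induction with
  | mem x hx =>
    obtain ⟨e, he, rfl⟩ := hx
    exact ⟨[e], [], by simpa using he, by simp, by simp⟩
  | zero => exact ⟨[], [], by simp, by simp, by simp⟩
  | add x y _ _ hx hy =>
    obtain ⟨P, Q, hP, hQ, h⟩ := hx
    obtain ⟨P', Q', hP', hQ', h'⟩ := hy
    refine ⟨P ++ P', Q ++ Q', ?_, ?_, ?_⟩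
    · intro e he
      exact (List.mem_append.1 he).elim (hP e) (hP' e)
    · intro e he
      exact (List.mem_append.1 he).elim (hQ e) (hQ' e)
    · rw [List.map_append, List.map_append, List.sum_append, List.sum_append, ← h, ← h']
      abel
  | neg x _ hx =>
    obtain ⟨P, Q, hP, hQ, h⟩ := hx
    refine ⟨Q, P, hQ, hP, ?_⟩
    rw [← h]
    abel

/-- If the lattice of `E` links all indices, three further pairs can be exchanged for members
of `E`: the pairs together with `Q` cover each index as often as `P` does, and the length of `P`
can be any sufficiently large number. -/
lemma exists_exchange_lists {E : Set (Finset ι)} (hE : ∀ e ∈ E, e.card = 3) (hne : E.Nonempty)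
    (hlink : ∀ i j, Linked E i j) (d : Fin 3 → Finset ι) (hd : ∀ k, (d k).card = 2) :
    ∃ N₀, ∀ N ≥ N₀, ∃ P Q : List (Finset ι), (∀ e ∈ P, e ∈ E) ∧ (∀ e ∈ Q, e ∈ E) ∧
      P.length = N ∧ ∀ i, (P.countP fun e => i ∈ e) =
        (Q ++ (List.finRange 3).map d).countP fun e => i ∈ e := by
  obtain ⟨e₀, he₀⟩ := hne
  obtain ⟨i₀, -⟩ : e₀.Nonempty := by rw [← card_pos, hE e₀ he₀]; norm_num
  -- Modulo the lattice all unit vectors agree with that of `i₀`, so only coordinate sums matter. A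
  -- member of `E` gives `3`, and the three pairs together give `6`.
  have hred : ∀ e : Finset ι, indicatorVec e - e.card • (Pi.single i₀ 1 : ι → ℤ) ∈
      spanLattice E := by
    intro e
    rw [indicatorVec, ← sum_const, ← sum_sub_distrib]
    exact AddSubgroup.sum_mem _ fun i _ => hlink i i₀
  have hthree : (3 : ℕ) • (Pi.single i₀ 1 : ι → ℤ) ∈ spanLattice E := by
    have h1 := hred e₀
    rw [hE e₀ he₀] at h1
    have h2 : indicatorVec e₀ ∈ spanLattice E :=
      AddSubgroup.subset_closure (Set.mem_image_of_mem _ he₀)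
    have := (spanLattice E).sub_mem h2 h1
    rwa [sub_sub_cancel] at this
  have hmem : (((List.finRange 3).map d).map indicatorVec).sum ∈ spanLattice E := by
    have h0 := hred (d 0)
    have h1 := hred (d 1)
    have h2 := hred (d 2)
    rw [hd] at h0 h1 h2
    have := (spanLattice E).add_mem ((spanLattice E).add_mem ((spanLattice E).add_mem h0 h1) h2)
      ((spanLattice E).add_mem hthree hthree)
    convert this using 1
    simp only [List.finRange_succ, List.finRange_zero, List.map_cons, List.map_nil, List.sum_cons,
      List.sum_nil, Fin.succ_zero_eq_one, Fin.succ_one_eq_two]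
    abel
  obtain ⟨P, Q, hP, hQ, hPQ⟩ := exists_lists_of_mem_spanLattice hmem
  -- Padding both lists with copies of `e₀` reaches every larger length.
  refine ⟨P.length, fun N hN => ⟨P ++ List.replicate (N - P.length) e₀,
    Q ++ List.replicate (N - P.length) e₀, ?_, ?_, ?_, ?_⟩⟩
  · intro e he
    rcases List.mem_append.1 he with h | h
    · exact hP e h
    · rwa [List.eq_of_mem_replicate h]
  · intro e he
    rcases List.mem_append.1 he with h | h
    · exact hQ e h
    · rwa [List.eq_of_mem_replicate h]
  · rw [List.length_append, List.length_replicate]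
    omega
  · intro i
    have h := congrFun hPQ i
    rw [Pi.add_apply, sum_indicatorVec_apply, sum_indicatorVec_apply, sum_indicatorVec_apply] at h
    rw [List.countP_append, List.countP_append, List.countP_append]
    have : List.countP (fun e => decide (i ∈ e)) ((List.finRange 3).map d) +
      List.countP (fun e => decide (i ∈ e)) Q = List.countP (fun e => decide (i ∈ e)) P := by
      exact_mod_cast h
    omega

lemma sum_countP_eq [Fintype ι] (P : List (Finset ι)) {r : ℕ} (hP : ∀ e ∈ P, e.card = r) :
    ∑ i, (P.countP fun e => i ∈ e) = r * P.length := by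
  induction P with
  | nil => simp
  | cons e P ih =>
    simp only [List.countP_cons, sum_add_distrib, decide_eq_true_eq]
    rw [ih fun e he => hP e (List.mem_cons_of_mem _ he)]
    simp [hP e List.mem_cons_self, mul_add]

/-- Used to declare each entry of an absorber a clone of some index, with prescribed numbers of
clones. -/
lemma exists_labelling [Fintype ι] {s : ι → ℕ} {m : ℕ} (hs : ∑ i, s i = m) :
    ∃ κ : Fin m → ι, ∀ i, (univ.filter fun α => κ α = i).card = s i := by
  have e : Fin m ≃ Σ i, Fin (s i) := (Fintype.equivFinOfCardEq (by simp [hs])).symm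
  refine ⟨fun α => (e α).1, fun i => ?_⟩
  have : (univ.filter fun α => (e α).1 = i).card =
      ((univ : Finset (Fin (s i))).map
        (Function.Embedding.sigmaMk (β := fun i => Fin (s i)) i)).card := by
    refine card_equiv e fun α => ?_
    simp only [mem_filter, mem_univ, true_and, mem_map, Function.Embedding.sigmaMk_apply]
    constructor
    · rintro rfl
      exact ⟨(e α).2, rfl⟩
    · rintro ⟨a, ha⟩
      rw [← ha]
  rw [this, card_map, card_univ, Fintype.card_fin]

end Multiplicities

/-! ### Absorbers from blow-ups -/

section Absorber

variable {V K : Type*} [DecidableEq V] {G : SimpleGraph V}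

/-- The entries of `u` are distinct, avoid `X`, and their set has a perfect rainbow-`K_3`-tiling
both on its own and together with `X`. -/
def Absorbs (c : G.EdgeLabeling K) (X : Finset V) {m : ℕ} (u : Fin m → V) : Prop :=
  Function.Injective u ∧ Disjoint (univ.image u) X ∧
    HasPerfectRainbowTiling c 3 (univ.image u) ∧ HasPerfectRainbowTiling c 3 (univ.image u ∪ X)

/-- The tuple `v` maps the index sets in `E` to rainbow triangles, and maps each pair `d k` to
a pair that forms a rainbow triangle with `x k`. -/
def Realizes (c : G.EdgeLabeling K) (x : Fin 3 → V) {ι : Type*} (E : Set (Finset ι))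
    (d : Fin 3 → Finset ι) (v : ι → V) : Prop :=
  (∀ e ∈ E, IsRainbowClique c 3 (e.image v)) ∧
    ∀ k, IsRainbowClique c 3 ((d k).image v ∪ {x k})

/-- Clones with distinct labels extend to a transversal of the blow-up, which lies in `R`. Hence `P`
gives the tiling without the `x k`, while `Q` and the pairs `d k`, completed by the `x k`, give the
one with them. -/
lemma absorbs_of_blowUp [Fintype V] {c : G.EdgeLabeling K} {x : Fin 3 → V}
    (hx : Function.Injective x) {M m : ℕ} (hm : 0 < m) {E : Set (Finset (Fin M))}
    {d : Fin 3 → Finset (Fin M)} {R : Finset (Fin M → V)} (hR : ∀ v ∈ R, Realizes c x E d v)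
    {P Q : List (Finset (Fin M))} (hP : ∀ e ∈ P, e ∈ E) (hQ : ∀ e ∈ Q, e ∈ E)
    (hPQ : ∀ i, (P.countP fun e => i ∈ e) =
      (Q ++ (List.finRange 3).map d).countP fun e => i ∈ e)
    {κ : Fin m → Fin M}
    (hκ : ∀ i, (univ.filter fun α => κ α = i).card = P.countP fun e => i ∈ e)
    {w : Fin M → Fin m → V} (hw : w ∈ blowUp R m)
    (hinj : Function.Injective fun α => w (κ α) α) (hxu : ∀ α k, w (κ α) α ≠ x k) :
    Absorbs c (univ.image x) fun α => w (κ α) α := by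
  set u : Fin m → V := fun α => w (κ α) α with hu
  have : Nonempty (Fin m) := ⟨⟨0, hm⟩⟩
  have hsection : ∀ B : Finset (Fin m), Set.InjOn κ B →
      ∃ v, Realizes c x E d v ∧ (B.image κ).image v = B.image u := by
    intro B hB
    have hs : ∀ α ∈ B, Function.invFunOn κ B (κ α) = α := fun α hα =>
      hB.leftInvOn_invFunOn hα
    refine ⟨fun i => w i (Function.invFunOn κ B i), hR _ ((mem_filter.1 hw).2 _), ?_⟩
    rw [image_image]
    refine image_congr fun α hα => ?_
    simp only [Function.comp_apply, hs α hα, hu]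
  have hdisj : Disjoint (univ.image u) (univ.image x) := by
    rw [disjoint_left]
    intro v hv hv'
    obtain ⟨α, -, rfl⟩ := mem_image.1 hv
    obtain ⟨k, -, hk⟩ := mem_image.1 hv'
    exact hxu α k hk.symm
  refine ⟨hinj, hdisj, ?_, ?_⟩
  · refine hasPerfectRainbowTiling_of_pieces κ u (P.map fun e => (e, ∅)) univ _ hinj.injOn ?_ ?_ ?_
      ?_ ?_
    · intro i
      rw [hκ, List.countP_map]
      rfl
    · intro q hq B _ hB hBq
      obtain ⟨e, he, rfl⟩ := List.mem_map.1 hq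
      obtain ⟨v, hv, hvB⟩ := hsection B hB
      rw [union_empty, ← hvB, hBq]
      exact hv.1 e (hP e he)
    · rw [List.pairwise_map]
      exact List.pairwise_of_forall fun _ _ => disjoint_empty_left _
    · intro q hq
      obtain ⟨e, he, rfl⟩ := List.mem_map.1 hq
      exact disjoint_empty_left _
    · intro v
      simp
  · refine hasPerfectRainbowTiling_of_pieces κ u ((Q.map fun e => (e, ∅)) ++
      (List.finRange 3).map fun k => (d k, {x k})) univ _ hinj.injOn ?_ ?_ ?_ ?_ ?_
    · intro i
      rw [hκ, hPQ, List.countP_append, List.countP_append, List.countP_map, List.countP_map,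
        List.countP_map]
      rfl
    · intro q hq B _ hB hBq
      obtain ⟨v, hv, hvB⟩ := hsection B hB
      rcases List.mem_append.1 hq with hq | hq
      · obtain ⟨e, he, rfl⟩ := List.mem_map.1 hq
        rw [union_empty, ← hvB, hBq]
        exact hv.1 e (hQ e he)
      · obtain ⟨k, hk, rfl⟩ := List.mem_map.1 hq
        rw [← hvB, hBq]
        exact hv.2 k
    · rw [List.pairwise_append, List.pairwise_map, List.pairwise_map]
      refine ⟨List.pairwise_of_forall fun _ _ => disjoint_empty_left _, ?_, ?_⟩
      · refine (List.nodup_finRange 3).imp fun {k l} hkl => ?_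
        simpa using fun h => hkl (hx h)
      · intro q hq q' _
        obtain ⟨e, he, rfl⟩ := List.mem_map.1 hq
        exact disjoint_empty_left _
    · intro q hq
      rcases List.mem_append.1 hq with hq | hq
      · obtain ⟨e, he, rfl⟩ := List.mem_map.1 hq
        exact disjoint_empty_left _
      · obtain ⟨k, hk, rfl⟩ := List.mem_map.1 hq
        rw [disjoint_singleton_left]
        exact fun h => disjoint_left.1 hdisj h (mem_image_of_mem x (mem_univ k))
    · intro v
      simp only [mem_union, mem_image, mem_univ, true_and, List.mem_append, List.mem_map,
        List.mem_finRange]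
      refine or_congr Iff.rfl ⟨?_, ?_⟩
      · rintro ⟨k, rfl⟩
        exact ⟨_, Or.inr ⟨k, rfl⟩, by simp⟩
      · rintro ⟨q, ⟨e, _, rfl⟩ | ⟨k, rfl⟩, hv⟩
        · simp at hv
        · exact ⟨k, (mem_singleton.1 hv).symm⟩

lemma card_filter_apply_eq {V : Type*} [Fintype V] [DecidableEq V] {m : ℕ} (α : Fin m) (a : V) :
    (univ.filter fun u : Fin m → V => u α = a).card * Fintype.card V = Fintype.card V ^ m := by
  have h1 := card_filter_comp (f := fun _ : Fin 1 => α) (Function.injective_of_subsingleton _)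
    {fun _ : Fin 1 => a}
  have h3 : (univ.filter fun u : Fin m → V =>
      u ∘ (fun _ : Fin 1 => α) ∈ ({fun _ : Fin 1 => a} : Finset (Fin 1 → V))) =
      univ.filter fun u : Fin m → V => u α = a := by
    ext u
    simp only [mem_filter, mem_univ, true_and, mem_singleton]
    exact ⟨fun h => congrFun h 0, fun h => funext fun _ => h⟩
  rw [h3, Fintype.card_fin, Fintype.card_fin, pow_one, card_singleton, one_mul] at h1
  exact h1

/-- Few tuples have a repeated entry or an entry among the `x k`. -/
lemma card_not_injective_le {V : Type*} [Fintype V] [DecidableEq V] {m l : ℕ} (x : Fin l → V) :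
    (univ.filter fun u : Fin m → V =>
        ¬ (Function.Injective u ∧ ∀ α k, u α ≠ x k)).card * Fintype.card V ≤
      (m ^ 2 + m * l) * Fintype.card V ^ m := by
  classical
  rcases Nat.eq_zero_or_pos (Fintype.card V) with h0 | hpos
  · simp [h0]
  have hpair : ∀ α β : Fin m, α ≠ β →
      (univ.filter fun u : Fin m → V => u α = u β).card * Fintype.card V =
        Fintype.card V ^ m := by
    intro α β hαβ
    have hf : Function.Injective ![α, β] := by
      intro i j
      fin_cases i <;> fin_cases j <;> simp [hαβ, hαβ.symm]
    have h1 := card_filter_comp hf (univ.image fun a : V => (fun _ : Fin 2 => a))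
    have h2 : (univ.image fun a : V => (fun _ : Fin 2 => a)).card = Fintype.card V := by
      rw [card_image_of_injective _ (fun a b h => congrFun h 0), card_univ]
    have h3 : (univ.filter fun u : Fin m → V =>
        u ∘ ![α, β] ∈ univ.image fun a : V => (fun _ : Fin 2 => a)) =
        univ.filter fun u : Fin m → V => u α = u β := by
      ext u
      simp only [mem_filter, mem_univ, true_and, mem_image]
      constructor
      · rintro ⟨a, ha⟩
        have e0 := congrFun ha 0
        have e1 := congrFun ha 1
        simp only [Function.comp_apply, Matrix.cons_val_zero, Matrix.cons_val_one] at e0 e1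
        rw [← e0, ← e1]
      · intro h
        refine ⟨u α, funext fun i => ?_⟩
        fin_cases i <;> simp [h]
    rw [h2, h3, Fintype.card_fin, Fintype.card_fin, pow_two, ← mul_assoc, mul_comm _ (_ ^ m)] at h1
    exact Nat.eq_of_mul_eq_mul_right hpos h1
  have hsub : (univ.filter fun u : Fin m → V =>
        ¬ (Function.Injective u ∧ ∀ α k, u α ≠ x k)) ⊆
      ((univ.filter fun p : Fin m × Fin m => p.1 ≠ p.2).biUnion fun p =>
        univ.filter fun u : Fin m → V => u p.1 = u p.2) ∪
      ((univ : Finset (Fin m × Fin l)).biUnion fun p =>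
        univ.filter fun u : Fin m → V => u p.1 = x p.2) := by
    intro u hu
    simp only [mem_filter, mem_univ, true_and, not_and_or, Function.Injective] at hu
    push Not at hu
    simp only [mem_union, mem_biUnion, mem_filter, mem_univ, true_and, Prod.exists]
    rcases hu with ⟨α, β, h, h'⟩ | ⟨α, k, h⟩
    · exact Or.inl ⟨α, β, h', h⟩
    · exact Or.inr ⟨α, k, h⟩
  have hle := (card_le_card hsub).trans ((card_union_le _ _).trans
    (Nat.add_le_add card_biUnion_le card_biUnion_le))
  refine (Nat.mul_le_mul_right _ hle).trans ?_
  rw [add_mul, add_mul, sum_mul, sum_mul]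
  refine Nat.add_le_add ?_ ?_
  · rw [sum_congr rfl fun p hp => hpair p.1 p.2 (mem_filter.1 hp).2, sum_const, smul_eq_mul]
    refine Nat.mul_le_mul_right _ ((card_filter_le _ _).trans ?_)
    simp [pow_two]
  · rw [sum_congr rfl fun p _ => card_filter_apply_eq p.1 (x p.2), sum_const, smul_eq_mul]
    simp

/-- The absorber read from a blow-up uses the positions `(κ α, α)`. These are distinct through their
second entry, so the density of blow-ups passes to absorbers, up to an `O(1/n)` loss from repeated
entries and entries among the `x k`. -/
lemma card_absorbers_ge [Fintype V] [Nonempty V] {c : G.EdgeLabeling K} {x : Fin 3 → V}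
    (hx : Function.Injective x) {M N : ℕ} (hN : 0 < N) {E : Set (Finset (Fin M))}
    (hE : ∀ e ∈ E, e.card = 3)
    {d : Fin 3 → Finset (Fin M)} {R : Finset (Fin M → V)} (hR : ∀ v ∈ R, Realizes c x E d v)
    {P Q : List (Finset (Fin M))} (hP : ∀ e ∈ P, e ∈ E) (hQ : ∀ e ∈ Q, e ∈ E)
    (hlen : P.length = N)
    (hPQ : ∀ i, (P.countP fun e => i ∈ e) =
      (Q ++ (List.finRange 3).map d).countP fun e => i ∈ e)
    {δ : ℝ} (hδ : 0 ≤ δ) (hRcard : δ * (Fintype.card V : ℝ) ^ M ≤ R.card) :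
    ∃ F : Finset (Fin (3 * N) → V), (∀ u ∈ F, Absorbs c (univ.image x) u) ∧
      (δ ^ ((3 * N) ^ M) - ((3 * N) ^ 2 + 3 * N * 3) / Fintype.card V) *
        (Fintype.card V : ℝ) ^ (3 * N) ≤ F.card := by
  classical
  have hn : (0 : ℝ) < Fintype.card V := by exact_mod_cast Fintype.card_pos
  set m := 3 * N with hm
  obtain ⟨κ, hκ⟩ := exists_labelling (s := fun i => P.countP fun e => i ∈ e) (m := m) (by
    rw [sum_countP_eq P (r := 3) fun e he => hE e (hP e he), hlen])
  let A : Finset (Fin m → V) := (blowUp R m).image fun w α => w (κ α) α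
  let bad : Finset (Fin m → V) := univ.filter fun u : Fin m → V =>
        ¬ (Function.Injective u ∧ ∀ α k, u α ≠ x k)
  refine ⟨A \ bad, ?_, ?_⟩
  · intro u hu
    simp only [A, bad, mem_sdiff, mem_image, mem_filter, mem_univ, true_and, not_not] at hu
    obtain ⟨⟨w, hw, rfl⟩, hinj, hxu⟩ := hu
    exact absorbs_of_blowUp hx (by omega) hR hP hQ hPQ hκ hw hinj hxu
  · have hf : Function.Injective fun α : Fin m => (κ α, α) := fun α β h => (Prod.ext_iff.1 h).2
    have h1 := card_filter_comp hf A
    rw [Fintype.card_prod, Fintype.card_fin, Fintype.card_fin] at h1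
    have h2 : (blowUp R m).card ≤ (univ.filter fun v : Fin M × Fin m → V =>
        v ∘ (fun α : Fin m => (κ α, α)) ∈ A).card := by
      refine card_le_card_of_injOn (fun w p => w p.1 p.2) ?_ ?_
      · intro w hw
        simp only [coe_filter, mem_univ, true_and, Set.mem_ofPred_eq]
        exact mem_image.2 ⟨w, hw, rfl⟩
      · intro w _ w' _ h
        funext i j
        exact congrFun h (i, j)
    have h3 := density_blowUp m M R
    have h4 : δ ≤ (R.card : ℝ) / (Fintype.card V : ℝ) ^ M := by
      rwa [le_div_iff₀ (by positivity)]
    have h5 : δ ^ (m ^ M) ≤ ((blowUp R m).card : ℝ) / ((Fintype.card V : ℝ) ^ m) ^ M :=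
      (pow_le_pow_left₀ hδ h4 _).trans h3
    have h6 : δ ^ (m ^ M) * (Fintype.card V : ℝ) ^ m ≤ A.card := by
      have e1 : ((blowUp R m).card : ℝ) * (Fintype.card V : ℝ) ^ m ≤
          A.card * (Fintype.card V : ℝ) ^ (M * m) := by
        have := Nat.mul_le_mul_right (Fintype.card V ^ m) h2
        rw [h1] at this
        exact_mod_cast this
      rw [le_div_iff₀ (by positivity), ← pow_mul, mul_comm m M] at h5
      have e2 : δ ^ (m ^ M) * (Fintype.card V : ℝ) ^ m * (Fintype.card V : ℝ) ^ (M * m) ≤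
          A.card * (Fintype.card V : ℝ) ^ (M * m) := by
        calc _ = δ ^ (m ^ M) * (Fintype.card V : ℝ) ^ (M * m) * (Fintype.card V : ℝ) ^ m := by ring
          _ ≤ ((blowUp R m).card : ℝ) * (Fintype.card V : ℝ) ^ m := by gcongr
          _ ≤ _ := e1
      exact le_of_mul_le_mul_right e2 (by positivity)
    have h7 : (bad.card : ℝ) ≤ (m ^ 2 + m * 3) / Fintype.card V * (Fintype.card V : ℝ) ^ m := by
      have := card_not_injective_le (m := m) x
      have : (bad.card : ℝ) * Fintype.card V ≤ (m ^ 2 + m * 3) * (Fintype.card V : ℝ) ^ m := by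
        exact_mod_cast this
      rw [div_mul_eq_mul_div, le_div_iff₀ hn]
      exact this
    have h8 : (A.card : ℝ) ≤ (A \ bad).card + bad.card := by
      exact_mod_cast (card_le_card (subset_union_left (s₁ := A) (s₂ := bad))).trans
        (by rw [← sdiff_union_self_eq_union]; exact card_union_le _ _)
    have hm' : (m : ℝ) = 3 * N := by rw [hm]; push_cast; ring
    rw [← hm']
    linarith

end Absorber

/-! ### Selecting one neighbour per colour -/

section Colours

variable {V K : Type*} {G : SimpleGraph V}

/-- `vw` and `vz` are edges of the same colour. -/
def SameColour (c : G.EdgeLabeling K) (v w z : V) : Prop :=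
  ∃ (h : G.Adj v w) (h' : G.Adj v z), c ⟨s(v, w), h⟩ = c ⟨s(v, z), h'⟩

lemma SameColour.symm {c : G.EdgeLabeling K} {v w z : V} (h : SameColour c v w z) :
    SameColour c v z w := by
  obtain ⟨h1, h2, h3⟩ := h
  exact ⟨h2, h1, h3.symm⟩

lemma SameColour.trans {c : G.EdgeLabeling K} {v w z y : V} (h : SameColour c v w z)
    (h' : SameColour c v z y) : SameColour c v w y := by
  obtain ⟨h1, h2, h3⟩ := h
  obtain ⟨h4, h5, h6⟩ := h'
  exact ⟨h1, h5, h3.trans h6⟩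

variable [DecidableEq V]

/-- Two edges of a triangle share a vertex, so colours need only be compared at each vertex. -/
lemma isRainbowClique_three {c : G.EdgeLabeling K} {T : Finset V} (hT : T.card = 3)
    (hadj : ∀ x ∈ T, ∀ y ∈ T, x ≠ y → G.Adj x y)
    (hcol : ∀ x ∈ T, ∀ y ∈ T, ∀ z ∈ T, y ≠ z → ¬ SameColour c x y z) :
    IsRainbowClique c 3 T := by
  refine ⟨⟨fun x hx y hy hxy => hadj x hx y hy hxy, hT⟩, ?_⟩
  rintro ⟨e, he⟩ ⟨f, hf⟩ heT hfT hef
  induction e using Sym2.ind with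
  | h p q =>
  induction f using Sym2.ind with
  | h p' q' =>
  have hp := heT p (Sym2.mem_mk_left p q)
  have hq := heT q (Sym2.mem_mk_right p q)
  have hp' := hfT p' (Sym2.mem_mk_left p' q')
  have hq' := hfT q' (Sym2.mem_mk_right p' q')
  have hsw : ∀ (a b : V) (h : s(a, b) ∈ G.edgeSet),
      (⟨s(a, b), h⟩ : G.edgeSet) = ⟨s(b, a), Sym2.eq_swap ▸ h⟩ := fun a b h =>
    Subtype.ext Sym2.eq_swap
  have key : ∀ (a b d : V) (h : s(a, b) ∈ G.edgeSet) (h' : s(a, d) ∈ G.edgeSet), a ∈ T → b ∈ T →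
      d ∈ T → c ⟨s(a, b), h⟩ = c ⟨s(a, d), h'⟩ →
      (⟨s(a, b), h⟩ : G.edgeSet) = ⟨s(a, d), h'⟩ := by
    intro a b d h h' ha hb hd hc
    by_cases hbd : b = d
    · subst hbd; rfl
    · exact (hcol a ha b hb d hd hbd ⟨h, h', hc⟩).elim
  have hpq : p ≠ q := G.ne_of_adj he
  have hpq' : p' ≠ q' := G.ne_of_adj hf
  by_cases h1 : p = p'
  · subst h1
    exact key _ _ _ _ _ hp hq hq' hef
  by_cases h2 : p = q'
  · subst h2
    rw [hsw p' p] at hef ⊢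
    exact key _ _ _ _ _ hp hq hp' hef
  by_cases h3 : q = p'
  · subst h3
    rw [hsw p q] at hef ⊢
    exact key _ _ _ _ _ hq hp hq' hef
  by_cases h4 : q = q'
  · subst h4
    rw [hsw p q, hsw p' q] at hef ⊢
    exact key _ _ _ _ _ hq hp hp' hef
  exfalso
  have hsub : ({p, q, p', q'} : Finset V) ⊆ T := by
    intro v hv
    simp only [mem_insert, mem_singleton] at hv
    rcases hv with rfl | rfl | rfl | rfl <;> assumption
  have hcard : ({p, q, p', q'} : Finset V).card = 4 := by
    rw [card_insert_of_notMem (by simp [hpq, h1, h2]), card_insert_of_notMem (by simp [h3, h4]),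
      card_pair hpq']
  have := card_le_card hsub
  omega

/-- `S` selects at every vertex out-neighbours joined to it by edges of distinct colours, such
that every selected colour appears at most `b` times at the vertex. -/
structure IsColourSelection [Fintype V] (c : G.EdgeLabeling K) (b : ℝ) (S : V → Finset V) :
    Prop where
  adj : ∀ v, ∀ w ∈ S v, G.Adj v w
  eq_of_sameColour : ∀ v, ∀ w ∈ S v, ∀ z ∈ S v, SameColour c v w z → w = z
  card_le : ∀ v, ∀ w ∈ S v, ∀ C : Finset V, (∀ z ∈ C, SameColour c v w z) → (C.card : ℝ) ≤ b

/-- Colours on more than `b` edges at `v` have disjoint classes, so there are at most `n/b` of them.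
They are dropped, and each remaining colour gets one representative. -/
lemma exists_colourSelection [Fintype V] (c : G.EdgeLabeling K) {b : ℝ} (hb : 0 < b) :
    ∃ S : V → Finset V, IsColourSelection c b S ∧
      ∀ v, (colourDegree c v : ℝ) - Fintype.card V / b ≤ (S v).card := by
  classical
  have hv : ∀ v, ∃ S : Finset V, (∀ w ∈ S, G.Adj v w) ∧
      (∀ w ∈ S, ∀ z ∈ S, SameColour c v w z → w = z) ∧
      (∀ w ∈ S, ∀ C : Finset V, (∀ z ∈ C, SameColour c v w z) → (C.card : ℝ) ≤ b) ∧
      (colourDegree c v : ℝ) - Fintype.card V / b ≤ S.card := by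
    intro v
    set Kv : Set K := {k : K | ∃ e : G.edgeSet, v ∈ (e : Sym2 V) ∧ c e = k} with hKv
    have hfin : Kv.Finite := by
      have : Kv ⊆ Set.range c := by
        rintro k ⟨e, -, rfl⟩
        exact ⟨e, rfl⟩
      exact (Set.finite_range c).subset this
    have hrep : ∀ k ∈ Kv, ∃ w, ∃ h : G.Adj v w, c ⟨s(v, w), h⟩ = k := by
      rintro k ⟨⟨e, he⟩, hve, rfl⟩
      obtain ⟨w, rfl⟩ := Sym2.mem_iff_exists.1 hve
      exact ⟨w, he, rfl⟩
    have : Nonempty V := ⟨v⟩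
    choose! rep hrep using hrep
    let cls : K → Finset V := fun k => univ.filter fun z => ∃ h : G.Adj v z, c ⟨s(v, z), h⟩ = k
    let small := hfin.toFinset.filter fun k => ((cls k).card : ℝ) ≤ b
    let large := hfin.toFinset.filter fun k => ¬ ((cls k).card : ℝ) ≤ b
    have hmem : ∀ k ∈ small, k ∈ Kv ∧ ((cls k).card : ℝ) ≤ b := by
      intro k hk
      simpa [small] using hk
    have hinj : Set.InjOn rep small := by
      intro k hk k' hk' h
      obtain ⟨h1, h2⟩ := hrep k (hmem k hk).1
      obtain ⟨h3, h4⟩ := hrep k' (hmem k' hk').1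
      rw [← h2, ← h4]
      congr 3
    refine ⟨small.image rep, ?_, ?_, ?_, ?_⟩
    · intro w hw
      obtain ⟨k, hk, rfl⟩ := mem_image.1 hw
      exact (hrep k (hmem k hk).1).1
    · intro w hw z hz hwz
      obtain ⟨k, hk, rfl⟩ := mem_image.1 hw
      obtain ⟨k', hk', rfl⟩ := mem_image.1 hz
      obtain ⟨h1, h2⟩ := hrep k (hmem k hk).1
      obtain ⟨h3, h4⟩ := hrep k' (hmem k' hk').1
      obtain ⟨h5, h6, h7⟩ := hwz
      rw [← h2.symm.trans (h7.trans h4)]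
    · intro w hw C hC
      obtain ⟨k, hk, rfl⟩ := mem_image.1 hw
      obtain ⟨h1, h2⟩ := hrep k (hmem k hk).1
      refine le_trans ?_ (hmem k hk).2
      exact_mod_cast card_le_card fun z hz => by
        obtain ⟨h3, h4, h5⟩ := hC z hz
        exact mem_filter.2 ⟨mem_univ z, h4, h5.symm.trans h2⟩
    · rw [card_image_of_injOn hinj]
      have h1 : (colourDegree c v : ℝ) = small.card + large.card := by
        have : colourDegree c v = hfin.toFinset.card := Set.ncard_eq_toFinset_card _ hfin
        rw [this]
        exact_mod_cast (card_filter_add_card_filter_not (s := hfin.toFinset)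
          (fun k => ((cls k).card : ℝ) ≤ b)).symm
      have h2 : (large.card : ℝ) * b ≤ Fintype.card V := by
        have e1 : (large.card : ℝ) * b ≤ ∑ k ∈ large, ((cls k).card : ℝ) := by
          rw [← nsmul_eq_mul, ← sum_const]
          refine sum_le_sum fun k hk => ?_
          exact (not_le.1 (mem_filter.1 hk).2).le
        have e2 : ∑ k ∈ large, (cls k).card = (large.biUnion cls).card := by
          refine (card_biUnion fun k _ k' _ hkk' => ?_).symm
          rw [Function.onFun, disjoint_left]
          intro z hz hz'
          obtain ⟨h1, h2⟩ := (mem_filter.1 hz).2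
          obtain ⟨h3, h4⟩ := (mem_filter.1 hz').2
          exact hkk' (h2.symm.trans h4)
        have e3 := card_le_univ (large.biUnion cls)
        rw [← e2] at e3
        exact e1.trans (by exact_mod_cast e3)
      have h3 : (large.card : ℝ) ≤ Fintype.card V / b := by
        rwa [le_div_iff₀ hb]
      linarith
  choose S h1 h2 h3 h4 using hv
  exact ⟨S, ⟨h1, h2, h3⟩, h4⟩

end Colours

/-! ### Good tuples and their configurations -/

section Sampling

variable {V K : Type*} [DecidableEq V] [Fintype V] {G : SimpleGraph V}

/-- The digraph induced on the indices of a tuple of vertices. -/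
def inducedOut (S : V → Finset V) {M : ℕ} (v : Fin M → V) (i : Fin M) : Finset (Fin M) :=
  univ.filter fun j => v j ∈ S (v i)

/-- The induced digraph has large out-degrees, each `x k` has many out-neighbours in the tuple,
and the selected edges cause no coincidence of colours. -/
structure IsGoodTuple (c : G.EdgeLabeling K) (S : V → Finset V) (x : Fin 3 → V) {M : ℕ}
    (v : Fin M → V) : Prop where
  outDegree : ∀ i, 2 * M < 3 * (inducedOut S v i).card
  outDegree_base : ∀ k, 2 * M < 3 * (univ.filter fun j => v j ∈ S (x k)).card
  colour : ∀ i j l, v j ∈ S (v i) → v j ≠ v l → ¬ SameColour c (v i) (v j) (v l)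
  colour_base : ∀ k i j, v j ∈ S (v i) → ¬ SameColour c (v i) (v j) (x k)

/-- At each vertex of an out-triangle one of the two edges is selected, so `colour` separates their
colours. The pair for `x k` is a double arc in its out-neighbourhood: both edges at `x k` are
selected, and `colour_base` applies at the ends of the arc. -/
lemma IsGoodTuple.exists_realizes {c : G.EdgeLabeling K} {b : ℝ} {S : V → Finset V}
    (hS : IsColourSelection c b S) {x : Fin 3 → V} {M : ℕ} (hM : 0 < M) {v : Fin M → V}
    (hv : IsGoodTuple c S x v) :
    ∃ (E : Set (Finset (Fin M))) (d : Fin 3 → Finset (Fin M)), Realizes c x E d v ∧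
      (∀ e ∈ E, e.card = 3) ∧ E.Nonempty ∧ (∀ i j, Linked E i j) ∧ ∀ k, (d k).card = 2 := by
  have hloop : ∀ i, i ∉ inducedOut S v i := by
    intro i hi
    exact G.irrefl (hS.adj _ _ (mem_filter.1 hi).2)
  have hdeg : ∀ i, 2 * Fintype.card (Fin M) < 3 * (inducedOut S v i).card := by
    simpa using hv.outDegree
  have hmem : ∀ {i j}, j ∈ inducedOut S v i → v j ∈ S (v i) := fun h => (mem_filter.1 h).2
  have hbase : ∀ k, ∃ p q : Fin M, v p ∈ S (x k) ∧ v q ∈ S (x k) ∧ v p ∈ S (v q) ∧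
      v q ∈ S (v p) := by
    intro k
    obtain ⟨p, hp, q, hq, h1, h2, -⟩ := exists_double_edge hdeg
      (A := univ.filter fun j => v j ∈ S (x k)) (by simpa using hv.outDegree_base k)
    exact ⟨p, q, (mem_filter.1 hp).2, (mem_filter.1 hq).2, hmem h1, hmem h2⟩
  choose p q hp hq hpq hqp using hbase
  refine ⟨{T | OutTriangle (inducedOut S v) T}, fun k => {p k, q k}, ⟨?_, ?_⟩, fun e he => he.1,
    ?_, linked_of_outDegree hloop hdeg, ?_⟩
  · rintro e ⟨hcard, hadj, hout⟩
    have hadj' : ∀ i ∈ e, ∀ j ∈ e, i ≠ j → G.Adj (v i) (v j) := by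
      intro i hi j hj hij
      rcases hadj i hi j hj hij with h | h
      · exact hS.adj _ _ (hmem h)
      · exact (hS.adj _ _ (hmem h)).symm
    have hinj : Set.InjOn v e := by
      intro i hi j hj hij
      by_contra hne
      exact G.ne_of_adj (hadj' i hi j hj hne) hij
    refine isRainbowClique_three (by rw [card_image_of_injOn hinj, hcard]) ?_ ?_
    · intro y hy z hz hyz
      obtain ⟨i, hi, rfl⟩ := mem_image.1 hy
      obtain ⟨j, hj, rfl⟩ := mem_image.1 hz
      exact hadj' i hi j hj fun h => hyz (by rw [h])
    · intro y hy z hz y' hy' hne hsame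
      obtain ⟨i, hi, rfl⟩ := mem_image.1 hy
      obtain ⟨j, hj, rfl⟩ := mem_image.1 hz
      obtain ⟨l, hl, rfl⟩ := mem_image.1 hy'
      have hij : i ≠ j := by
        rintro rfl
        exact G.irrefl hsame.1
      have hil : i ≠ l := by
        rintro rfl
        exact G.irrefl hsame.2.1
      have hjl : j ≠ l := by
        rintro rfl
        exact hne rfl
      have he : ({i, j, l} : Finset (Fin M)) = e := by
        refine eq_of_subset_of_card_le ?_ ?_
        · intro a ha
          simp only [mem_insert, mem_singleton] at ha
          rcases ha with rfl | rfl | rfl <;> assumption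
        · rw [hcard, card_triple_eq_three_iff.2 ⟨hij, hil, hjl⟩]
      obtain ⟨a, ha, hia⟩ := hout i hi
      rw [← he] at ha
      simp only [mem_insert, mem_singleton] at ha
      rcases ha with rfl | rfl | rfl
      · exact hloop _ hia
      · exact hv.colour i a l (hmem hia) hne hsame
      · exact hv.colour i a j (hmem hia) hne.symm hsame.symm
  · intro k
    have a1 := hS.adj _ _ (hp k)
    have a2 := hS.adj _ _ (hq k)
    have a3 := hS.adj _ _ (hpq k)
    have himg : ({p k, q k} : Finset (Fin M)).image v ∪ {x k} = {v (p k), v (q k), x k} := by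
      ext y
      simp
    rw [himg]
    have n1 : v (p k) ≠ v (q k) := a3.ne'
    refine isRainbowClique_three
      (card_triple_eq_three_iff.2 ⟨n1, a1.ne', a2.ne'⟩) ?_ ?_
    · simp only [mem_insert, mem_singleton]
      rintro y (rfl | rfl | rfl) z (rfl | rfl | rfl) hyz <;>
        first | exact (hyz rfl).elim | assumption | (apply SimpleGraph.Adj.symm; assumption)
    · have b0 : ∀ y z, ¬ SameColour c y y z := fun y z h => G.irrefl h.1
      have c1 := hv.colour_base k (p k) (q k) (hqp k)
      have c2 := hv.colour_base k (q k) (p k) (hpq k)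
      have c3 : ¬ SameColour c (x k) (v (p k)) (v (q k)) := fun h =>
        n1 (hS.eq_of_sameColour _ _ (hp k) _ (hq k) h)
      simp only [mem_insert, mem_singleton]
      rintro y (rfl | rfl | rfl) z (rfl | rfl | rfl) y' (rfl | rfl | rfl) hne hsame <;>
        first
        | exact hne rfl
        | exact b0 _ _ hsame
        | exact b0 _ _ hsame.symm
        | exact c1 hsame
        | exact c1 hsame.symm
        | exact c2 hsame
        | exact c2 hsame.symm
        | exact c3 hsame
        | exact c3 hsame.symm
  · obtain ⟨a, ha, b, hb, h1, h2, -⟩ := exists_double_edge hdeg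
      (A := inducedOut S v ⟨0, hM⟩) (hdeg _)
    exact ⟨_, OutTriangle.of_double hloop h2 h1 hb (Or.inl ha)⟩
  · intro k
    refine card_pair ?_
    intro h
    have := hpq k
    rw [h] at this
    exact G.irrefl (hS.adj _ _ this)

end Sampling

/-! ### Most tuples are good -/

section Sampling

variable {V K : Type*} [DecidableEq V] [Fintype V] {G : SimpleGraph V}

/-- Tail parameter `s = ε`, density `1/3 - ε/2`, threshold about `M/3`: the linear terms cancel, and
`ε ^ 2 / 2` beats `ε ^ 2 / 3`. -/
lemma tail_exponent_le {ε : ℝ} (hε : 0 < ε) {M : ℝ} (hM : 0 ≤ M) (hε1 : ε ≤ 1) {r : ℝ}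
    (hr : M / 3 - 1 ≤ r) :
    (1 / 3 - ε / 2) * (ε + ε ^ 2) * M - ε * r ≤ 1 - M * (ε ^ 2 / 6) := by
  have h1 : 0 ≤ M * ε ^ 3 := by positivity
  nlinarith [mul_le_mul_of_nonneg_left hr hε.le]

/-- Almost all tuples are good. -/
lemma card_goodTuple_ge [Nonempty V] {c : G.EdgeLabeling K} {ε γ : ℝ} (hε : 0 < ε) (hε1 : ε ≤ 1 / 3)
    {S : V → Finset V} (hS : IsColourSelection c (γ * Fintype.card V) S) (hγ : 0 ≤ γ)
    (hdeg : ∀ v, (2 / 3 + ε / 2) * (Fintype.card V : ℝ) ≤ (S v).card) (x : Fin 3 → V) (M : ℕ) :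
    ∃ A : Finset (Fin M → V), (∀ v ∈ A, IsGoodTuple c S x v) ∧
      (1 - ((M + 3) * Real.exp (1 - M * (ε ^ 2 / 6)) + M ^ 3 * γ + 3 * M ^ 2 / Fintype.card V)) *
        (Fintype.card V : ℝ) ^ M ≤ A.card := by
  classical
  set n := Fintype.card V with hn
  have hnpos : (0 : ℝ) < n := by exact_mod_cast Fintype.card_pos
  have hcompl : ∀ v, (((S v)ᶜ).card : ℝ) ≤ (1 / 3 - ε / 2) * n := by
    intro v
    have h1 : ((S v).card : ℝ) + ((S v)ᶜ).card = n := by exact_mod_cast card_add_card_compl (S v)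
    have := hdeg v
    linarith
  have hp0 : (0 : ℝ) ≤ 1 / 3 - ε / 2 := by linarith
  let B1 : Fin M → Finset (Fin M → V) := fun i => univ.filter fun v =>
    ((M : ℝ) / 3 - 1) + 1 ≤ ((univ.filter fun j => v j ∈ (S (v i))ᶜ).card : ℝ)
  let B2 : Fin 3 → Finset (Fin M → V) := fun k => univ.filter fun v =>
    (M : ℝ) / 3 ≤ ((univ.filter fun j => v j ∈ (S (x k))ᶜ).card : ℝ)
  let B3 : Fin M × Fin M × Fin M → Finset (Fin M → V) := fun p => univ.filter fun v =>
    v p.2.1 ∈ S (v p.1) ∧ v p.2.1 ≠ v p.2.2 ∧ SameColour c (v p.1) (v p.2.1) (v p.2.2)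
  let B4 : Fin 3 × Fin M × Fin M → Finset (Fin M → V) := fun p => univ.filter fun v =>
    v p.2.2 ∈ S (v p.2.1) ∧ SameColour c (v p.2.1) (v p.2.2) (x p.1)
  have hB1 : ∀ i, ((B1 i).card : ℝ) ≤ (n : ℝ) ^ M * Real.exp (1 - M * (ε ^ 2 / 6)) := by
    intro i
    refine (card_out_tail_le i (fun u => (S u)ᶜ) hcompl hp0 hε.le (by linarith)).trans ?_
    refine mul_le_mul_of_nonneg_left (Real.exp_le_exp.2 ?_) (by positivity)
    exact tail_exponent_le hε (Nat.cast_nonneg M) (by linarith) le_rfl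
  have hB2 : ∀ k, ((B2 k).card : ℝ) ≤ (n : ℝ) ^ M * Real.exp (1 - M * (ε ^ 2 / 6)) := by
    intro k
    refine (card_tail_le (J := Fin M) (S (x k))ᶜ (hcompl _) hε.le (by linarith)).trans ?_
    rw [Fintype.card_fin]
    refine mul_le_mul_of_nonneg_left (Real.exp_le_exp.2 ?_) (by positivity)
    exact tail_exponent_le hε (Nat.cast_nonneg M) (by linarith) (sub_le_self _ zero_le_one)
  -- Given `v i` and a selected `v j`, at most `γ n` vertices repeat the colour; this is why
  -- frequent colours were dropped.
  have hB3 : ∀ p, ((B3 p).card : ℝ) ≤ γ * (n : ℝ) ^ M := by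
    rintro ⟨i, j, l⟩
    by_cases hd : i ≠ j ∧ i ≠ l ∧ j ≠ l
    · have hf : Function.Injective ![i, j, l] := by
        obtain ⟨h1, h2, h3⟩ := hd
        intro a b
        fin_cases a <;> fin_cases b <;> simp [h1, h2, h3, h1.symm, h2.symm, h3.symm]
      let Q : Finset (Fin 3 → V) := univ.filter fun y =>
        y 1 ∈ S (y 0) ∧ y 1 ≠ y 2 ∧ SameColour c (y 0) (y 1) (y 2)
      have h1 := card_filter_comp hf Q
      have h2 : (univ.filter fun v : Fin M → V => v ∘ ![i, j, l] ∈ Q) = B3 (i, j, l) := by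
        ext v
        simp [Q, B3]
      have h3 : (Q.card : ℝ) ≤ γ * n * n ^ 2 := by
        have e1 : Q.card ≤ ((univ : Finset (V × V)).sigma fun a =>
            univ.filter fun z => a.2 ∈ S a.1 ∧ SameColour c a.1 a.2 z).card := by
          refine card_le_card_of_injOn (fun y => ⟨(y 0, y 1), y 2⟩) ?_ ?_
          · intro y hy
            simp only [Q, coe_filter, mem_univ, true_and, Set.mem_ofPred_eq] at hy
            simp [hy.1, hy.2.2]
          · intro y _ y' _ h
            simp only [Sigma.mk.injEq, Prod.mk.injEq, heq_eq_eq] at h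
            funext a
            fin_cases a
            exacts [h.1.1, h.1.2, h.2]
        have e2 : ∀ a : V × V, ((univ.filter fun z =>
            a.2 ∈ S a.1 ∧ SameColour c a.1 a.2 z).card : ℝ) ≤ γ * n := by
          intro a
          by_cases ha : a.2 ∈ S a.1
          · exact hS.card_le a.1 a.2 ha _ fun z hz => (mem_filter.1 hz).2.2
          · simp only [ha, false_and, filter_false, card_empty, Nat.cast_zero]
            positivity
        rw [card_sigma] at e1
        calc (Q.card : ℝ) ≤ ∑ a : V × V, ((univ.filter fun z =>
            a.2 ∈ S a.1 ∧ SameColour c a.1 a.2 z).card : ℝ) := by exact_mod_cast e1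
          _ ≤ ∑ a : V × V, γ * n := sum_le_sum fun a _ => e2 a
          _ = γ * n * n ^ 2 := by
            rw [sum_const, card_univ, Fintype.card_prod, nsmul_eq_mul, ← hn]
            push_cast
            ring
      rw [h2, Fintype.card_fin, Fintype.card_fin] at h1
      have h4 : ((B3 (i, j, l)).card : ℝ) * n ^ 3 = Q.card * (n : ℝ) ^ M := by exact_mod_cast h1
      have h5 : ((B3 (i, j, l)).card : ℝ) * n ^ 3 ≤ γ * (n : ℝ) ^ M * n ^ 3 := by
        rw [h4]
        calc (Q.card : ℝ) * (n : ℝ) ^ M ≤ γ * n * n ^ 2 * (n : ℝ) ^ M := by gcongr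
          _ = _ := by ring
      exact le_of_mul_le_mul_right h5 (by positivity)
    · have : B3 (i, j, l) = ∅ := by
        rw [eq_empty_iff_forall_notMem]
        intro v hv
        obtain ⟨h1, h2, h3⟩ := (mem_filter.1 hv).2
        refine hd ⟨?_, ?_, ?_⟩
        · rintro rfl
          exact G.irrefl h3.1
        · rintro rfl
          exact G.irrefl h3.2.1
        · rintro rfl
          exact h2 rfl
      rw [this, card_empty, Nat.cast_zero]
      positivity
  -- Here `x k` is fixed: given `v i`, at most one selected out-neighbour has the colour of the edge
  -- to `x k`.
  have hB4 : ∀ p, ((B4 p).card : ℝ) ≤ (n : ℝ) ^ M / n := by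
    rintro ⟨k, i, j⟩
    by_cases hd : i ≠ j
    · have hf : Function.Injective ![i, j] := by
        intro a b
        fin_cases a <;> fin_cases b <;> simp [hd, hd.symm]
      let Q : Finset (Fin 2 → V) := univ.filter fun y =>
        y 1 ∈ S (y 0) ∧ SameColour c (y 0) (y 1) (x k)
      have h1 := card_filter_comp hf Q
      have h2 : (univ.filter fun v : Fin M → V => v ∘ ![i, j] ∈ Q) = B4 (k, i, j) := by
        ext v
        simp [Q, B4]
      have h3 : Q.card ≤ n := by
        rw [hn, ← card_univ]
        refine card_le_card_of_injOn (fun y => y 0) (by simp) ?_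
        intro y hy y' hy' h
        simp only [Q, coe_filter, mem_univ, true_and, Set.mem_ofPred_eq] at hy hy'
        simp only at h
        rw [← h] at hy'
        funext a
        fin_cases a
        · exact h
        · exact hS.eq_of_sameColour _ _ hy.1 _ hy'.1 (hy.2.trans hy'.2.symm)
      rw [h2, Fintype.card_fin, Fintype.card_fin] at h1
      have h4 : ((B4 (k, i, j)).card : ℝ) * n ^ 2 = Q.card * (n : ℝ) ^ M := by exact_mod_cast h1
      have h5 : ((B4 (k, i, j)).card : ℝ) * n ^ 2 ≤ n * (n : ℝ) ^ M := by
        rw [h4]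
        gcongr
      rw [le_div_iff₀ hnpos]
      have h6 : ((B4 (k, i, j)).card : ℝ) * n * n ≤ (n : ℝ) ^ M * n := by linarith
      exact le_of_mul_le_mul_right h6 hnpos
    · have : B4 (k, i, j) = ∅ := by
        rw [eq_empty_iff_forall_notMem]
        intro v hv
        obtain ⟨h1, h3⟩ := (mem_filter.1 hv).2
        refine hd ?_
        rintro rfl
        exact G.irrefl h3.1
      rw [this, card_empty, Nat.cast_zero]
      positivity
  let bad := (univ.biUnion B1 ∪ univ.biUnion B2) ∪ (univ.biUnion B3 ∪ univ.biUnion B4)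
  have hbad : (bad.card : ℝ) ≤ ((M + 3) * Real.exp (1 - M * (ε ^ 2 / 6)) + M ^ 3 * γ +
      3 * M ^ 2 / n) * (n : ℝ) ^ M := by
    have e : bad.card ≤ (∑ i, (B1 i).card + ∑ k, (B2 k).card) +
        (∑ p, (B3 p).card + ∑ p, (B4 p).card) :=
      (card_union_le _ _).trans (Nat.add_le_add
        ((card_union_le _ _).trans (Nat.add_le_add card_biUnion_le card_biUnion_le))
        ((card_union_le _ _).trans (Nat.add_le_add card_biUnion_le card_biUnion_le)))
    have e' : (bad.card : ℝ) ≤ (∑ i, ((B1 i).card : ℝ) + ∑ k, ((B2 k).card : ℝ)) +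
        (∑ p, ((B3 p).card : ℝ) + ∑ p, ((B4 p).card : ℝ)) := by exact_mod_cast e
    have s1 := sum_le_sum fun i (_ : i ∈ univ) => hB1 i
    have s2 := sum_le_sum fun i (_ : i ∈ univ) => hB2 i
    have s3 := sum_le_sum fun i (_ : i ∈ univ) => hB3 i
    have s4 := sum_le_sum fun i (_ : i ∈ univ) => hB4 i
    simp only [sum_const, card_univ, Fintype.card_prod, Fintype.card_fin, nsmul_eq_mul] at s1 s2 s3 s4
    push_cast at s1 s2 s3 s4
    calc (bad.card : ℝ) ≤ _ := e'
      _ ≤ _ := add_le_add (add_le_add s1 s2) (add_le_add s3 s4)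
      _ = _ := by ring
  refine ⟨badᶜ, ?_, ?_⟩
  · intro v hv
    simp only [bad, B1, B2, B3, B4, mem_compl, mem_union, mem_biUnion, mem_filter, mem_univ,
      true_and, not_or, not_exists] at hv
    obtain ⟨⟨h1, h2⟩, h3, h4⟩ := hv
    have hcount : ∀ T : Finset V, ¬ ((M : ℝ) / 3 ≤ ((univ.filter fun j => v j ∈ Tᶜ).card : ℝ)) →
        2 * M < 3 * (univ.filter fun j => v j ∈ T).card := by
      intro T hT
      have e1 := card_filter_add_card_filter_not (s := (univ : Finset (Fin M))) (fun j => v j ∈ T)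
      simp only [mem_compl] at hT
      rw [card_univ, Fintype.card_fin] at e1
      have e2 : 3 * (univ.filter fun j => v j ∉ T).card < M := by
        have : (3 * (univ.filter fun j => v j ∉ T).card : ℝ) < M := by linarith
        exact_mod_cast this
      omega
    refine ⟨fun i => hcount _ (by simpa using h1 i), fun k => hcount _ (by simpa using h2 k), ?_, ?_⟩
    · intro i j l hij hne hsame
      exact h3 (i, j, l) ⟨hij, hne, hsame⟩
    · intro k i j hij hsame
      exact h4 (k, i, j) ⟨hij, hsame⟩
  · have h1 : (bad.card : ℝ) + badᶜ.card = (n : ℝ) ^ M := by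
      have := card_add_card_compl bad
      rw [Fintype.card_fun, Fintype.card_fin] at this
      exact_mod_cast this
    linarith

end Sampling

/-! ### A positive density of absorbers for every triple -/

lemma exists_forall_pow_mul_exp_lt (k : ℕ) (C : ℝ) {b : ℝ} (hb : 0 < b) :
    ∃ n₀ : ℕ, ∀ n : ℕ, n₀ ≤ n → C * (n : ℝ) ^ k * Real.exp (-(b * n)) < 1 := by
  have h1 : Filter.Tendsto (fun n : ℕ => b * (n : ℝ)) Filter.atTop Filter.atTop :=
    tendsto_natCast_atTop_atTop.const_mul_atTop hb
  have h2 := ((Real.tendsto_pow_mul_exp_neg_atTop_nhds_zero k).comp h1).const_mul (C / b ^ k)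
  rw [mul_zero] at h2
  obtain ⟨n₀, hn₀⟩ := Filter.eventually_atTop.1 (h2.eventually (gt_mem_nhds one_pos))
  refine ⟨n₀, fun n hn => ?_⟩
  have := hn₀ n hn
  simp only [Function.comp_apply] at this
  refine lt_of_eq_of_lt ?_ this
  rw [mul_pow]
  field_simp

/-- In a graph of large minimum colour degree, every three vertices have a positive proportion of
all tuples of a fixed length as absorbers. -/
theorem exists_many_absorbers.{u, v} {ε : ℝ} (hε : 0 < ε) (hε1 : ε ≤ 1 / 3) :
    ∃ N : ℕ, 0 < N ∧ ∃ η : ℝ, 0 < η ∧ ∃ n₀ : ℕ, ∀ (V : Type u) (K : Type v) [Fintype V]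
      [DecidableEq V] (G : SimpleGraph V) (c : G.EdgeLabeling K), n₀ ≤ Fintype.card V →
      (2 / 3 + ε) * (Fintype.card V : ℝ) ≤ (minColourDegree c : ℝ) →
      ∀ X : Finset V, X.card = 3 → ∃ F : Finset (Fin (3 * N) → V),
        (∀ u ∈ F, Absorbs c X u) ∧ η * (Fintype.card V : ℝ) ^ (3 * N) ≤ F.card := by
  classical
  -- With `M + 3 ≤ 4 * M`, the factor 32 makes the tail term at most 1/8.
  obtain ⟨M₀, hM₀⟩ := exists_forall_pow_mul_exp_lt 1 (32 * Real.exp 1) (b := ε ^ 2 / 6)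
    (by positivity)
  set M := max M₀ 1 with hMdef
  have hM : 0 < M := lt_of_lt_of_le one_pos (le_max_right _ _)
  have hM1 : (1 : ℝ) ≤ M := by exact_mod_cast hM
  have hMexp : (M + 3) * Real.exp (1 - M * (ε ^ 2 / 6)) ≤ 1 / 8 := by
    have h1 := hM₀ M (le_max_left _ _)
    rw [pow_one] at h1
    rw [sub_eq_add_neg, Real.exp_add, mul_comm (M : ℝ) (ε ^ 2 / 6)]
    have h2 : (M + 3 : ℝ) * (Real.exp 1 * Real.exp (-(ε ^ 2 / 6 * M))) ≤
        4 * M * (Real.exp 1 * Real.exp (-(ε ^ 2 / 6 * M))) := by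
      gcongr
      linarith
    linarith
  -- a uniform absorber length for all configurations on `M` indices
  let Ty := Set (Finset (Fin M)) × (Fin 3 → Finset (Fin M))
  have : Finite Ty := inferInstance
  have : Fintype Ty := Fintype.ofFinite Ty
  let nice : Ty → Prop := fun τ => (∀ e ∈ τ.1, e.card = 3) ∧ τ.1.Nonempty ∧
    (∀ i j, Linked τ.1 i j) ∧ ∀ k, (τ.2 k).card = 2
  have hlen : ∀ τ : Ty, ∃ N₀, nice τ → ∀ N ≥ N₀, ∃ P Q : List (Finset (Fin M)),
      (∀ e ∈ P, e ∈ τ.1) ∧ (∀ e ∈ Q, e ∈ τ.1) ∧ P.length = N ∧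
      ∀ i, (P.countP fun e => i ∈ e) =
        (Q ++ (List.finRange 3).map τ.2).countP fun e => i ∈ e := by
    intro τ
    by_cases h : nice τ
    · obtain ⟨N₀, hN₀⟩ := exists_exchange_lists h.1 h.2.1 h.2.2.1 τ.2 h.2.2.2
      exact ⟨N₀, fun _ => hN₀⟩
    · exact ⟨0, fun h' => (h h').elim⟩
  choose N₀ hN₀ using hlen
  set N := univ.sup N₀ + 1 with hN
  set t : ℝ := (Fintype.card Ty : ℝ) with ht
  have : Nonempty Ty := ⟨(∅, fun _ => ∅)⟩
  have htpos : 0 < t := by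
    rw [ht]
    exact_mod_cast Fintype.card_pos
  -- At least half of all tuples are good, and some one of the `t` configurations takes at least a
  -- `1/t` share of them.
  set δ : ℝ := 1 / (2 * t) with hδ
  have hδpos : 0 < δ := by positivity
  set γ : ℝ := 1 / (8 * M ^ 3) with hγ
  have hγpos : 0 < γ := by positivity
  set ρ : ℝ := δ ^ ((3 * N) ^ M) with hρ
  have hρpos : 0 < ρ := by positivity
  -- The summands ensure, in order, `3 M ^ 2 / n ≤ 1/8`, a loss of at most `ε n / 2` to frequent
  -- colours, and a loss of at most half the absorbers to repetitions; the final 1 gives `n > 0`.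
  obtain ⟨n₁, hn₁⟩ := exists_nat_ge (24 * (M : ℝ) ^ 2 + 2 / (γ * ε) +
    2 * ((3 * N) ^ 2 + 3 * N * 3) / ρ + 1)
  refine ⟨N, Nat.succ_pos _, ρ / 2, by positivity, n₁, ?_⟩
  intro V K _ _ G c hn hdeg X hX
  set n := Fintype.card V with hncard
  have hnR : 24 * (M : ℝ) ^ 2 + 2 / (γ * ε) + 2 * ((3 * N) ^ 2 + 3 * N * 3) / ρ + 1 ≤ n :=
    hn₁.trans (by exact_mod_cast hn)
  have p1 : 0 ≤ 24 * (M : ℝ) ^ 2 := by positivity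
  have p2 : 0 ≤ 2 / (γ * ε) := by positivity
  have p3 : 0 ≤ 2 * ((3 * (N : ℝ)) ^ 2 + 3 * N * 3) / ρ := by positivity
  have hnpos : (0 : ℝ) < n := by linarith
  have hVne : Nonempty V := by
    rw [← Fintype.card_pos_iff]
    exact_mod_cast hnpos
  obtain ⟨S, hS, hScard⟩ := exists_colourSelection c (b := γ * n) (by positivity)
  have hSdeg : ∀ v, (2 / 3 + ε / 2) * (n : ℝ) ≤ (S v).card := by
    intro v
    have h1 := hScard v
    have h2 : (minColourDegree c : ℝ) ≤ colourDegree c v := by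
      exact_mod_cast ciInf_le' (fun v => colourDegree c v) v
    have h3 : (Fintype.card V : ℝ) / (γ * n) = 1 / γ := by
      rw [← hncard]
      field_simp
    have h4 : 1 / γ ≤ ε / 2 * n := by
      have : 2 / (γ * ε) ≤ n := by linarith
      rw [div_le_iff₀ (by positivity)] at this ⊢
      linarith
    rw [h3] at h1
    linarith
  let x : Fin 3 → V := fun k => (X.equivFinOfCardEq hX).symm k
  have hx : Function.Injective x := fun a b h =>
    (X.equivFinOfCardEq hX).symm.injective (Subtype.ext h)
  have hxX : univ.image x = X := by
    refine eq_of_subset_of_card_le ?_ ?_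
    · intro y hy
      obtain ⟨k, -, rfl⟩ := mem_image.1 hy
      exact ((X.equivFinOfCardEq hX).symm k).2
    · rw [card_image_of_injective _ hx, hX]
      simp
  obtain ⟨A, hA, hAcard⟩ := card_goodTuple_ge hε hε1 hS hγpos.le hSdeg x M
  have hAcard' : (n : ℝ) ^ M / 2 ≤ A.card := by
    refine le_trans ?_ hAcard
    have e1 : (M : ℝ) ^ 3 * γ = 1 / 8 := by
      rw [hγ]
      field_simp
    have e2 : 3 * (M : ℝ) ^ 2 / n ≤ 1 / 8 := by
      rw [div_le_iff₀ hnpos]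
      linarith
    have e3 : (0 : ℝ) < (n : ℝ) ^ M := by positivity
    rw [← hncard, e1]
    nlinarith
  have hreal : ∀ v, ∃ τ : Ty, v ∈ A → nice τ ∧ Realizes c x τ.1 τ.2 v := by
    intro v
    by_cases hv : v ∈ A
    · obtain ⟨E, d, h1, h2, h3, h4, h5⟩ := (hA v hv).exists_realizes hS hM
      exact ⟨(E, d), fun _ => ⟨⟨h2, h3, h4, h5⟩, h1⟩⟩
    · exact ⟨Classical.arbitrary _, fun h => (hv h).elim⟩
  choose τ hτ using hreal
  obtain ⟨σ, -, hσ⟩ := exists_le_card_fiber_of_nsmul_le_card_of_maps_to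
    (s := A) (t := univ) (f := τ) (b := δ * (n : ℝ) ^ M) (fun _ _ => mem_univ _) univ_nonempty (by
      rw [card_univ, nsmul_eq_mul, ← ht]
      refine le_trans (le_of_eq ?_) hAcard'
      rw [hδ]
      field_simp)
  set R := A.filter fun v => τ v = σ with hR
  have hRreal : ∀ v ∈ R, Realizes c x σ.1 σ.2 v := by
    intro v hv
    rw [hR, mem_filter] at hv
    have := (hτ v hv.1).2
    rwa [hv.2] at this
  have hnice : nice σ := by
    have : 0 < R.card := by
      have : (0 : ℝ) < R.card := lt_of_lt_of_le (by positivity) hσ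
      exact_mod_cast this
    obtain ⟨v, hv⟩ := card_pos.1 this
    rw [hR, mem_filter] at hv
    have := (hτ v hv.1).1
    rwa [hv.2] at this
  obtain ⟨P, Q, hP, hQ, hPlen, hPQ⟩ := hN₀ σ hnice N
    ((le_sup (mem_univ σ)).trans (Nat.le_succ _))
  obtain ⟨F, hF, hFcard⟩ := card_absorbers_ge hx (Nat.succ_pos _) hnice.1 hRreal hP hQ hPlen hPQ
    hδpos.le hσ
  rw [hxX] at hF
  refine ⟨F, hF, le_trans ?_ hFcard⟩
  refine mul_le_mul_of_nonneg_right ?_ (by positivity)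
  have e1 : ((3 * (N : ℝ)) ^ 2 + 3 * N * 3) / n ≤ ρ / 2 := by
    have : 2 * ((3 * (N : ℝ)) ^ 2 + 3 * N * 3) / ρ ≤ n := by linarith
    rw [div_le_iff₀ (by positivity)] at this ⊢
    linarith
  rw [← hncard, ← hρ]
  linarith

/-! ### Choosing a disjoint family of absorbers -/

section Selection

variable {V : Type*} [Fintype V] [DecidableEq V]

lemma card_meets_le {m : ℕ} (Z : Finset V) :
    (univ.filter fun u : Fin m → V => ∃ α, u α ∈ Z).card * Fintype.card V ≤
      m * Z.card * Fintype.card V ^ m := by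
  have hsub : (univ.filter fun u : Fin m → V => ∃ α, u α ∈ Z) ⊆
      ((univ : Finset (Fin m)) ×ˢ Z).biUnion fun p =>
        univ.filter fun u : Fin m → V => u p.1 = p.2 := by
    intro u hu
    obtain ⟨α, hα⟩ := (mem_filter.1 hu).2
    exact mem_biUnion.2 ⟨(α, u α), mem_product.2 ⟨mem_univ _, hα⟩, by simp⟩
  refine (Nat.mul_le_mul_right _ ((card_le_card hsub).trans card_biUnion_le)).trans ?_
  rw [sum_mul, sum_congr rfl fun p _ => card_filter_apply_eq p.1 p.2, sum_const, smul_eq_mul,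
    card_product, card_univ, Fintype.card_fin]

/-- Greedy selection of disjoint tuples that keeps the potential `∑ 2 ^ (-hits)` small. -/
lemma exists_disjoint_family [Nonempty V] {I : Type*} (𝒳 : Finset I) {m : ℕ} (hm : 0 < m)
    (A : I → Finset (Fin m → V)) {η : ℝ}
    (hA : ∀ X ∈ 𝒳, η * (Fintype.card V : ℝ) ^ m ≤ (A X).card) (r : ℕ)
    (hr : (m : ℝ) ^ 2 * r ≤ η / 2 * Fintype.card V) :
    ∃ F : Finset (Fin m → V), F.card ≤ r ∧
      (∀ u ∈ F, ∀ u' ∈ F, u ≠ u' → Disjoint (univ.image u) (univ.image u')) ∧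
      ∑ X ∈ 𝒳, (1 / 2 : ℝ) ^ (F.filter fun u => u ∈ A X).card ≤ 𝒳.card * (1 - η / 4) ^ r := by
  set n := Fintype.card V with hn
  have hnpos : (0 : ℝ) < n := by exact_mod_cast Fintype.card_pos
  induction r with
  | zero => exact ⟨∅, by simp, by simp, by simp⟩
  | succ r ih =>
    have hr' : (m : ℝ) ^ 2 * r ≤ η / 2 * n := by
      refine le_trans ?_ hr
      push_cast
      nlinarith [sq_nonneg (m : ℝ)]
    obtain ⟨F, hFcard, hFdisj, hF⟩ := ih hr'
    by_cases h𝒳 : 𝒳 = ∅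
    · subst h𝒳
      exact ⟨F, hFcard.trans (Nat.le_succ r), hFdisj, by simp⟩
    set Z := F.biUnion fun u => univ.image u with hZ
    have hZcard : (Z.card : ℝ) ≤ r * m := by
      have h1 : Z.card ≤ F.card * m := card_biUnion_le_card_mul _ _ _ fun u _ =>
        card_image_le.trans (by simp)
      have h2 : F.card * m ≤ r * m := Nat.mul_le_mul_right _ hFcard
      exact_mod_cast h1.trans h2
    let meets : Finset (Fin m → V) := univ.filter fun u : Fin m → V => ∃ α, u α ∈ Z
    let A' : I → Finset (Fin m → V) := fun X => A X \ meets
    -- By `hr`, the vertices already used spoil at most half of the guaranteed absorbers of each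
    -- `X`.
    have hmeets : (meets.card : ℝ) ≤ η / 2 * (n : ℝ) ^ m := by
      have h1 : (meets.card : ℝ) * n ≤ m * Z.card * (n : ℝ) ^ m := by
        exact_mod_cast card_meets_le (m := m) Z
      have h2 : (m : ℝ) * Z.card * (n : ℝ) ^ m ≤ η / 2 * n * (n : ℝ) ^ m := by
        refine mul_le_mul_of_nonneg_right ?_ (by positivity)
        calc (m : ℝ) * Z.card ≤ m * (r * m) := by gcongr
          _ = (m : ℝ) ^ 2 * r := by ring
          _ ≤ _ := hr'
      have h3 : (meets.card : ℝ) * n ≤ η / 2 * (n : ℝ) ^ m * n := by linarith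
      exact le_of_mul_le_mul_right h3 hnpos
    have hA' : ∀ X ∈ 𝒳, η / 2 * (n : ℝ) ^ m ≤ (A' X).card := by
      intro X hX
      have h1 : ((A X).card : ℝ) ≤ (A' X).card + meets.card := by
        exact_mod_cast (card_le_card (subset_union_left (s₁ := A X) (s₂ := meets))).trans
          (by rw [← sdiff_union_self_eq_union]; exact card_union_le _ _)
      have := hA X hX
      linarith
    let f : I → ℝ := fun X => (1 / 2 : ℝ) ^ (F.filter fun u => u ∈ A X).card
    have hf : ∀ X, 0 < f X := fun X => by positivity
    have hcard : ((univ : Finset (Fin m → V)).card : ℝ) = (n : ℝ) ^ m := by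
      rw [card_univ, Fintype.card_fun, Fintype.card_fin]
      push_cast
      rfl
    -- A uniformly random `u` halves the term of `X` with probability at least `η/2`, so the
    -- expected potential shrinks by the factor `1 - η/4`.
    obtain ⟨u, -, hu⟩ : ∃ u ∈ (univ : Finset (Fin m → V)),
        ∑ X ∈ 𝒳, f X * (if u ∈ A' X then 1 / 2 else 1) ≤ (1 - η / 4) * ∑ X ∈ 𝒳, f X := by
      refine exists_le_of_sum_le univ_nonempty ?_
      rw [sum_comm, sum_const, nsmul_eq_mul, hcard, mul_sum, mul_sum]
      refine sum_le_sum fun X hX => ?_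
      rw [← mul_sum]
      have h1 : ∑ u : Fin m → V, (if u ∈ A' X then (1 / 2 : ℝ) else 1) =
          (n : ℝ) ^ m - (A' X).card / 2 := by
        have : ∀ u, (if u ∈ A' X then (1 / 2 : ℝ) else 1) = 1 - if u ∈ A' X then 1 / 2 else 0 := by
          intro u
          split_ifs <;> norm_num
        simp only [this, sum_sub_distrib, sum_ite_mem, univ_inter, sum_const, nsmul_eq_mul, mul_one,
          hcard]
        ring
      rw [h1]
      have h2 := hA' X hX
      have h3 : (n : ℝ) ^ m - (A' X).card / 2 ≤ (n : ℝ) ^ m * (1 - η / 4) := by linarith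
      calc f X * ((n : ℝ) ^ m - (A' X).card / 2) ≤ f X * ((n : ℝ) ^ m * (1 - η / 4)) := by
            have := (hf X).le
            gcongr
        _ = _ := by ring
    have hη4 : 0 ≤ 1 - η / 4 := by
      obtain ⟨X, hX⟩ := nonempty_iff_ne_empty.2 h𝒳
      have h1 := hA X hX
      have h2 : ((A X).card : ℝ) ≤ (n : ℝ) ^ m := by
        rw [← hcard]
        exact_mod_cast card_le_univ (A X)
      have h3 : (0 : ℝ) < (n : ℝ) ^ m := by positivity
      have h4 : η ≤ 1 := by
        by_contra! hc
        nlinarith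
      linarith
    have hΦ : ∑ X ∈ 𝒳, f X * (if u ∈ A' X then 1 / 2 else 1) ≤
        𝒳.card * (1 - η / 4) ^ (r + 1) := by
      refine hu.trans ((mul_le_mul_of_nonneg_left hF hη4).trans (le_of_eq ?_))
      ring
    -- A tuple that meets an earlier one lies in no `A' X`, so the potential bound then holds with
    -- `F` unchanged.
    by_cases hmeet : u ∈ meets
    · refine ⟨F, hFcard.trans (Nat.le_succ r), hFdisj, le_trans (le_of_eq ?_) hΦ⟩
      refine sum_congr rfl fun X _ => ?_
      simp [A', f, hmeet]
    · have hdisjZ : ∀ u' ∈ F, Disjoint (univ.image u) (univ.image u') := by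
        intro u' hu'
        rw [disjoint_left]
        intro v hv hv'
        obtain ⟨α, -, rfl⟩ := mem_image.1 hv
        exact hmeet (mem_filter.2 ⟨mem_univ u, α, mem_biUnion.2 ⟨u', hu', hv'⟩⟩)
      have huF : u ∉ F := by
        intro h
        have h1 := hdisjZ u h
        rw [disjoint_self, bot_eq_empty, image_eq_empty] at h1
        exact (univ_nonempty_iff.2 ⟨(⟨0, hm⟩ : Fin m)⟩).ne_empty h1
      refine ⟨insert u F, ?_, ?_, le_trans (le_of_eq ?_) hΦ⟩
      · rw [card_insert_of_notMem huF]
        omega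
      · intro a ha b hb hab
        rcases mem_insert.1 ha with hau | ha' <;> rcases mem_insert.1 hb with hbu | hb'
        · exact (hab (hau.trans hbu.symm)).elim
        · exact hau ▸ hdisjZ b hb'
        · exact hbu ▸ (hdisjZ a ha').symm
        · exact hFdisj a ha' b hb' hab
      · refine sum_congr rfl fun X _ => ?_
        by_cases huA : u ∈ A X
        · rw [filter_insert, if_pos huA, card_insert_of_notMem (by simp [huF]), pow_succ,
            if_pos (mem_sdiff.2 ⟨huA, hmeet⟩)]
        · rw [filter_insert, if_neg huA, if_neg fun h => huA (mem_sdiff.1 h).1, mul_one]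

end Selection

/-! ### Absorbing a set three vertices at a time -/

section Absorption

variable {V K : Type*} [DecidableEq V] {G : SimpleGraph V} {c : G.EdgeLabeling K}

lemma hasPerfectRainbowTiling_biUnion {m : ℕ} (F : Finset (Fin m → V))
    (hdisj : ∀ u ∈ F, ∀ u' ∈ F, u ≠ u' → Disjoint (univ.image u) (univ.image u'))
    (htile : ∀ u ∈ F, HasPerfectRainbowTiling c 3 (univ.image u)) :
    HasPerfectRainbowTiling c 3 (F.biUnion fun u => univ.image u) := by
  induction F using Finset.induction_on with
  | empty =>
    rw [biUnion_empty]
    exact HasPerfectRainbowTiling.empty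
  | insert u F hu ih =>
    rw [biUnion_insert]
    refine (htile u (mem_insert_self _ _)).union (ih ?_ ?_) ?_
    · exact fun a ha b hb => hdisj a (mem_insert_of_mem ha) b (mem_insert_of_mem hb)
    · exact fun a ha => htile a (mem_insert_of_mem ha)
    · rw [disjoint_biUnion_right]
      intro b hb
      refine hdisj u (mem_insert_self _ _) b (mem_insert_of_mem hb) ?_
      rintro rfl
      exact hu hb

/-- A disjoint family that contains at least `k` absorbers for every three vertices of `U` absorbs
`U` if `U` has `3 * k` vertices. -/
lemma hasPerfectRainbowTiling_absorb {m : ℕ} (k : ℕ) :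
    ∀ (F : Finset (Fin m → V)) (U : Finset V),
      (∀ u ∈ F, ∀ u' ∈ F, u ≠ u' → Disjoint (univ.image u) (univ.image u')) →
      (∀ u ∈ F, HasPerfectRainbowTiling c 3 (univ.image u)) →
      U.card = 3 * k → Disjoint U (F.biUnion fun u => univ.image u) →
      (∀ X ⊆ U, X.card = 3 → ∃ B ⊆ F, (∀ u ∈ B, Absorbs c X u) ∧ k ≤ B.card) →
      HasPerfectRainbowTiling c 3 (U ∪ F.biUnion fun u => univ.image u) := by
  induction k with
  | zero =>
    intro F U hdisj htile hU _ _
    rw [mul_zero, card_eq_zero] at hU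
    rw [hU, empty_union]
    exact hasPerfectRainbowTiling_biUnion F hdisj htile
  | succ k ih =>
    intro F U hdisj htile hU hUF habs
    obtain ⟨X, hXU, hX⟩ := exists_subset_card_eq (s := U) (n := 3) (by omega)
    obtain ⟨B, hBF, hB, hBcard⟩ := habs X hXU hX
    obtain ⟨u, huB⟩ : B.Nonempty := by
      rw [← card_pos]; omega
    have huF := hBF huB
    have hFeq : F.biUnion (fun u => univ.image u) =
        univ.image u ∪ (F.erase u).biUnion fun u => univ.image u := by
      conv_lhs => rw [← insert_erase huF]
      rw [biUnion_insert]
    have hrest : HasPerfectRainbowTiling c 3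
        ((U \ X) ∪ (F.erase u).biUnion fun u => univ.image u) := by
      refine ih _ _ ?_ ?_ ?_ ?_ ?_
      · exact fun a ha b hb => hdisj a (mem_of_mem_erase ha) b (mem_of_mem_erase hb)
      · exact fun a ha => htile a (mem_of_mem_erase ha)
      · rw [card_sdiff_of_subset hXU]
        omega
      · exact hUF.mono sdiff_subset (biUnion_subset_biUnion_of_subset_left _ (erase_subset _ _))
      -- Removing `u` costs each triple at most one absorber, and one fewer is needed.
      · intro Y hY hYcard
        obtain ⟨B', hB'F, hB', hB'card⟩ := habs Y (hY.trans sdiff_subset) hYcard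
        refine ⟨B'.erase u, erase_subset_erase _ hB'F, fun a ha => hB' a (mem_of_mem_erase ha), ?_⟩
        have := pred_card_le_card_erase (s := B') (a := u)
        omega
    have hu := (hB u huB).2.2.2
    have hdis : Disjoint ((U \ X) ∪ (F.erase u).biUnion fun u => univ.image u)
        (univ.image u ∪ X) := by
      rw [disjoint_union_left, disjoint_union_right, disjoint_union_right]
      rw [hFeq, disjoint_union_right] at hUF
      refine ⟨⟨hUF.1.mono_left sdiff_subset, sdiff_disjoint⟩, ?_, (hUF.2.mono_left hXU).symm⟩
      rw [disjoint_biUnion_left]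
      intro b hb
      rw [mem_erase] at hb
      exact hdisj b hb.2 u huF hb.1
    have := hrest.union hu hdis
    convert this using 1
    rw [hFeq]
    ext v
    have hXU' : v ∈ X → v ∈ U := fun h => hXU h
    simp only [mem_union, mem_sdiff]
    tauto

end Absorption

end RainbowTiling

/-! ### The absorbing set -/

open Finset RainbowTiling

theorem lemmaA1 (ε : ℝ) (hε : 0 < ε) :
    ∃ φ₀ : ℝ, 0 < φ₀ ∧ ∀ φ : ℝ, 0 < φ → φ ≤ φ₀ →
      ∃ n₀ : ℕ, ∀ (V K : Type*) [Fintype V] [DecidableEq V]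
        (G : SimpleGraph V) (c : G.EdgeLabeling K),
        n₀ ≤ Fintype.card V →
        (2 / 3 + ε) * (Fintype.card V : ℝ) ≤ (RainbowTiling.minColourDegree c : ℝ) →
        ∃ W : Finset V, (W.card : ℝ) ≤ ε * (Fintype.card V : ℝ) ∧
          RainbowTiling.HasPerfectRainbowTiling c 3 W ∧
          ∀ U : Finset V, Disjoint U W → (U.card : ℝ) ≤ φ * (Fintype.card V : ℝ) →
            3 ∣ U.card → RainbowTiling.HasPerfectRainbowTiling c 3 (U ∪ W) := by
  classical
  -- Lowering `ε` only weakens the degree assumption; the bound on `|W|` uses the original `ε`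
  -- through `κ`.
  obtain ⟨N, hN, η₀, hη₀, n₁, habs⟩ := exists_many_absorbers (ε := min ε (1 / 3))
    (lt_min hε (by norm_num)) (min_le_right _ _)
  set m := 3 * N with hm
  have hmpos : (0 : ℝ) < m := by
    rw [hm]
    exact_mod_cast Nat.mul_pos (by norm_num) hN
  set η := min η₀ 1 with hη
  have hηpos : 0 < η := lt_min hη₀ one_pos
  have hη1 : η ≤ 1 := min_le_right _ _
  -- About `κ n` tuples are selected: the first bound is what the greedy choice allows, the second
  -- gives `|W| ≤ ε n`.
  set κ := min (η / (2 * (m : ℝ) ^ 2)) (ε / m) with hκ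
  have hκpos : 0 < κ := lt_min (by positivity) (by positivity)
  obtain ⟨n₂, hn₂⟩ := exists_forall_pow_mul_exp_lt 3 (Real.exp (η / 4)) (b := η * κ / 8)
    (by positivity)
  refine ⟨η * κ / 8, by positivity, fun φ _ hφ => ⟨max (max n₁ n₂) 1, ?_⟩⟩
  intro V K _ _ G c hn hdeg
  set n := Fintype.card V with hncard
  have hn1 : n₁ ≤ n := (le_max_left _ _).trans ((le_max_left _ _).trans hn)
  have hn2 : n₂ ≤ n := (le_max_right _ _).trans ((le_max_left _ _).trans hn)
  have hnpos : 0 < n := lt_of_lt_of_le one_pos ((le_max_right _ _).trans hn)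
  have hVne : Nonempty V := Fintype.card_pos_iff.1 hnpos
  have hdeg' : (2 / 3 + min ε (1 / 3)) * (n : ℝ) ≤ (minColourDegree c : ℝ) := by
    refine le_trans ?_ hdeg
    gcongr
    exact min_le_left _ _
  have hA : ∀ X : Finset V, ∃ F : Finset (Fin m → V), X.card = 3 →
      (∀ u ∈ F, Absorbs c X u) ∧ η * (n : ℝ) ^ m ≤ F.card := by
    intro X
    by_cases hX : X.card = 3
    · obtain ⟨F, hF, hFcard⟩ := habs V K G c hn1 hdeg' X hX
      refine ⟨F, fun _ => ⟨hF, le_trans ?_ hFcard⟩⟩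
      gcongr
      exact min_le_left _ _
    · exact ⟨∅, fun h => (hX h).elim⟩
  choose A hA using hA
  set r := ⌊κ * n⌋₊ with hr
  have hrle : (r : ℝ) ≤ κ * n := Nat.floor_le (by positivity)
  have hrge : κ * n - 1 ≤ r := (Nat.sub_one_lt_floor _).le
  obtain ⟨F, hFcard, hFdisj, hF⟩ := exists_disjoint_family (powersetCard 3 (univ : Finset V))
    (by omega : 0 < m) A (fun X hX => (hA X (mem_powersetCard.1 hX).2).2) r (by
      calc (m : ℝ) ^ 2 * r ≤ (m : ℝ) ^ 2 * (η / (2 * (m : ℝ) ^ 2) * n) := by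
            gcongr
            refine hrle.trans ?_
            gcongr
            exact min_le_left _ _
        _ = η / 2 * n := by field_simp)
  -- With fewer hits, `X` alone would contribute at least `exp (-η κ n / 8)` to the potential, whose
  -- total is at most `n ^ 3 * exp (η / 4 - η κ n / 4)`. This fails for large `n`.
  have hhits : ∀ X : Finset V, X.card = 3 →
      η * κ / 8 * n ≤ ((F.filter fun u => u ∈ A X).card : ℝ) := by
    intro X hX
    by_contra! hlt
    have hX' : X ∈ powersetCard 3 (univ : Finset V) := mem_powersetCard.2 ⟨subset_univ X, hX⟩
    set h := (F.filter fun u => u ∈ A X).card with hh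
    have h1 : (1 / 2 : ℝ) ^ h ≤
        (powersetCard 3 (univ : Finset V)).card * (1 - η / 4) ^ r :=
      (single_le_sum (f := fun X => (1 / 2 : ℝ) ^ (F.filter fun u => u ∈ A X).card)
        (fun _ _ => by positivity) hX').trans hF
    have h2 : Real.exp (-(η * κ / 8 * n)) ≤ (1 / 2 : ℝ) ^ h := by
      have e1 : Real.exp (-1) ≤ 1 / 2 := by
        rw [Real.exp_neg, one_div]
        exact inv_anti₀ two_pos (by linarith [Real.add_one_le_exp 1])
      calc Real.exp (-(η * κ / 8 * n)) ≤ Real.exp (h * (-1)) := by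
            apply Real.exp_le_exp.2
            linarith
        _ = Real.exp (-1) ^ h := Real.exp_nat_mul _ _
        _ ≤ _ := pow_le_pow_left₀ (Real.exp_pos _).le e1 _
    have h3 : ((powersetCard 3 (univ : Finset V)).card : ℝ) ≤ (n : ℝ) ^ 3 := by
      rw [card_powersetCard, card_univ]
      exact_mod_cast Nat.choose_le_pow n 3
    have h4 : (1 - η / 4) ^ r ≤ Real.exp (η / 4 - η * κ / 4 * n) := by
      calc (1 - η / 4) ^ r ≤ Real.exp (-(η / 4)) ^ r := by
            refine pow_le_pow_left₀ (by linarith) ?_ r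
            linarith [Real.add_one_le_exp (-(η / 4))]
        _ = Real.exp (r * (-(η / 4))) := (Real.exp_nat_mul _ _).symm
        _ ≤ _ := by
          apply Real.exp_le_exp.2
          nlinarith
    have h5 : Real.exp (-(η * κ / 8 * n)) ≤
        (n : ℝ) ^ 3 * Real.exp (η / 4 - η * κ / 4 * n) := by
      refine h2.trans (h1.trans ?_)
      have : 0 ≤ (1 - η / 4) ^ r := pow_nonneg (by linarith) r
      gcongr
    have h6 : (n : ℝ) ^ 3 * Real.exp (η / 4 - η * κ / 4 * n) =
        Real.exp (η / 4) * (n : ℝ) ^ 3 * Real.exp (-(η * κ / 8 * n)) *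
          Real.exp (-(η * κ / 8 * n)) := by
      have : η / 4 - η * κ / 4 * n = η / 4 + -(η * κ / 8 * n) + -(η * κ / 8 * n) := by ring
      rw [this, Real.exp_add, Real.exp_add]
      ring
    rw [h6] at h5
    have h7 := mul_lt_mul_of_pos_right (hn₂ n hn2) (Real.exp_pos (-(η * κ / 8 * n)))
    rw [one_mul] at h7
    exact absurd h5 (not_le.2 h7)
  -- Selected tuples that serve no triple need not have a tiling of their own, so they are
  -- discarded.
  let F' := F.filter fun u => ∃ X : Finset V, X.card = 3 ∧ u ∈ A X
  have hF'disj : ∀ u ∈ F', ∀ u' ∈ F', u ≠ u' → Disjoint (univ.image u) (univ.image u') :=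
    fun u hu u' hu' => hFdisj u (mem_filter.1 hu).1 u' (mem_filter.1 hu').1
  have hF'tile : ∀ u ∈ F', HasPerfectRainbowTiling c 3 (univ.image u) := by
    intro u hu
    obtain ⟨X, hX, huX⟩ := (mem_filter.1 hu).2
    exact ((hA X hX).1 u huX).2.2.1
  refine ⟨F'.biUnion fun u => univ.image u, ?_, hasPerfectRainbowTiling_biUnion F' hF'disj hF'tile,
    ?_⟩
  · have h1 : (F'.biUnion fun u => univ.image u).card ≤ r * m :=
      (card_biUnion_le_card_mul _ _ m fun u _ => card_image_le.trans (by simp)).trans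
        (Nat.mul_le_mul_right _ ((card_filter_le _ _).trans hFcard))
    calc ((F'.biUnion fun u => univ.image u).card : ℝ) ≤ r * m := by exact_mod_cast h1
      _ ≤ κ * n * m := by gcongr
      _ ≤ ε / m * n * m := by
        gcongr
        exact min_le_right _ _
      _ = ε * n := by field_simp
  · rintro U hUW hUcard ⟨k, hk⟩
    refine hasPerfectRainbowTiling_absorb k F' U hF'disj hF'tile hk hUW fun X hXU hX => ?_
    refine ⟨F.filter fun u => u ∈ A X, ?_, fun u hu => (hA X hX).1 u (mem_filter.1 hu).2, ?_⟩
    · intro u hu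
      rw [mem_filter] at hu
      exact mem_filter.2 ⟨hu.1, X, hX, hu.2⟩
    · have h1 := hhits X hX
      have h2 : (U.card : ℝ) = 3 * k := by rw [hk]; push_cast; ring
      have h3 : φ * (n : ℝ) ≤ η * κ / 8 * n := by gcongr
      have h4 : (k : ℝ) ≤ ((F.filter fun u => u ∈ A X).card : ℝ) := by
        have : (0 : ℝ) ≤ k := Nat.cast_nonneg k
        linarith
      exact_mod_cast h4
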